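/- **Setting.** Fix an integer $k\ge 2$, a finite non-empty set $\Omega$, a finite set $\Psi$ of weight functions $\psi:\Omega^k\to(0,2)$ with a prior distribution $p$ on $\Psi$, and a probability distribution $D$ on $\{0,\dots,\Delta\}$. Let $n\ge 1$ be such that a *$D$-partition* of $[n]$ exists, i.e. a degree sequence $d:[n]\to\{0,\dots,\Delta\}$ with $|\{x: d(x)=l\}|=nD(l)$ for all $l$, and let $\boldsymbol d$ be a uniformly random $D$-partition. A graph is a list of check nodes $a$, in the order of creation, each with a neighbourhood $\partial a\in[n]^k$. For $\delta:[n]\to\mathbb N$, $\delta\ne0$, let $\nu_\delta(x)=\delta(x)/\sum_y\delta(y)$. *Configuration model from $\delta$.* Neighbours are drawn one after the other from $\nu_\delta$, where $\delta(x)$ is reduced by one each time $x$ is drawn; each block of $k$ successive draws is the neighbourhood of a new check node. The $(D,k)$-graph has $M=\lfloor k^{-1}\sum_x \boldsymbol d(x)\rfloor$ check nodes generated in this way from $\delta=\boldsymbol d$. *Layered multi-Poisson $(\alpha,\beta)$-approximation.* Let $s_{\max}=\lfloor(1-\alpha)\beta^{-1}k^{-1}\sum_x\boldsymbol d(x)\rfloor$,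 let $\boldsymbol m_1,\dots,\boldsymbol m_{s_{\max}}$ be independent ${\rm Po}(\beta)$ variables, and $\delta_1=\boldsymbol d$. In layer $s=1,\dots,s_{\max}$ add $\boldsymbol m_s$ check nodes with neighbourhoods drawn independently from $\nu_{\delta_s}^{\otimes k}$, and then put $\delta_{s+1}=\max(\delta_s-\nabla_s,0)$, where $\nabla_s(x)$ is the number of times $x$ was drawn in layer $s$. (If the residual degrees are exhausted, uniform draws are used by convention.) The *missing check nodes* are $\max(M-N,0)$ further check nodes, $N$ being the number of check nodes of the approximation, generated by the configuration model from $\delta_{s_{\max}+1}$. *Weights.* Let $\boldsymbol\sigma^*\in\Omega^n$ be uniformly random and independent of the graph. Given $\boldsymbol\sigma^*$ and the graph, independently every check node $a$ with neighbours $\partial_1a\le\dots\le\partial_ka$ in ascending order receives the weight function $\psi$ with probability proportional to $p(\psi)\psi(\boldsymbol\sigma^*(\partial_1a),\dots,\boldsymbol\sigma^*(\partial_ka))$. Write $\boldsymbol G^*_{D}$ and $\boldsymbol G^*_{\alpha,\beta,D}$ for the resulting weighted graphs over the $(D,k)$-graph and over the approximation; missing check nodes of the latter receive weights in the same way. **Proposition.**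 There are a function $f:(0,1)\times(0,\infty)\to\mathbb R$, bounded on $[\varepsilon,1)\times(0,B]$ for all $\varepsilon,B>0$, and a constant $C$, neither depending on $n$ (and $C$ not depending on $\alpha,\beta$ either), such that for all $\alpha\in(0,1)$ and $\beta>0$: 1. For every $n$ as above there is a coupling of $\boldsymbol G^*_{\alpha,\beta,D}$, its missing check nodes, and $\boldsymbol G^*_D$, such that, once the missing check nodes have been appended to $\boldsymbol G^*_{\alpha,\beta,D}$, the expected number of check nodes with different neighbourhoods in the two graphs is at most $f(\alpha,\beta)$. Here the $i$-th check nodes are compared with each other, and a check node present in only one of the graphs counts as different. 2. The number of missing check nodes is $O(\alpha n)$: for all sufficiently large $n$ as above (depending on $\alpha,\beta$) its expectation is at most $C\alpha n$, and the probability that it exceeds $C\alpha n$ tends to $0$ as $n\to\infty$ through such $n$. -/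

import Mathlib

open scoped ENNReal NNReal

noncomputable section

namespace FactorGraph

/-! ### Generic tools -/

/-- `j` independent samples from `μ`. -/
def iid {γ : Type*} (μ : PMF γ) : (j : ℕ) → PMF (Fin j → γ)
  | 0 => PMF.pure Fin.elim0
  | j + 1 => μ.bind fun a => (iid μ j).bind fun v => PMF.pure (Fin.cons a v)

/-- The expectation of a nonnegative (possibly infinite) quantity under a discrete law. -/
def expect {γ : Type*} (μ : PMF γ) (g : γ → ℝ≥0∞) : ℝ≥0∞ := ∑' x, μ x * g x

/-- The Poisson distribution as a discrete law on `ℕ`, `j ↦ e^{-r} r^j / j!`. -/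
def poisson (r : ℝ≥0) : PMF ℕ := (ProbabilityTheory.poissonMeasure r).toPMF

theorem poisson_apply (r : ℝ≥0) (j : ℕ) :
    poisson r j = ENNReal.ofReal (Real.exp (-r) * (r : ℝ) ^ j / j.factorial) := by
  rw [poisson, MeasureTheory.Measure.toPMF_apply, ProbabilityTheory.poissonMeasure_singleton]

/-! ### Random neighbourhoods

A check node of an unweighted graph on the variable nodes `Fin n` is its neighbourhood
`Fin k → Fin n`; a graph is the list of its check nodes in the order of their creation. -/

section Unweighted

variable {n : ℕ} [NeZero n]

/-- The distribution `ν` on the variable nodes proportional to the residual degrees `δ`. If no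
residual degree is left (where the generation of the approximate graph is considered to have
failed) the uniform distribution is used, by convention. -/
def socketLaw (δ : Fin n → ℕ) : PMF (Fin n) :=
  if h : ∑ x, δ x = 0 then PMF.uniformOfFintype (Fin n)
  else PMF.normalize (fun x => (δ x : ℝ≥0∞))
    (by rw [tsum_fintype]; exact_mod_cast h)
    (by rw [tsum_fintype]; exact_mod_cast ENNReal.natCast_ne_top _)

/-- Draw `j` sockets one after the other, updating the residual degrees after every draw.
Returns the drawn variable nodes and the final residual degrees. -/
def drawUpdating : (j : ℕ) → (Fin n → ℕ) → PMF ((Fin j → Fin n) × (Fin n → ℕ))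
  | 0, δ => PMF.pure (Fin.elim0, δ)
  | j + 1, δ => (socketLaw δ).bind fun x =>
      (drawUpdating j (fun y => δ y - if y = x then 1 else 0)).bind fun q =>
        PMF.pure (Fin.cons x q.1, q.2)

/-- Generate `r` check nodes by the configuration model, from the residual degrees `δ`. -/
def configChecks (k : ℕ) : (r : ℕ) → (Fin n → ℕ) → PMF (List (Fin k → Fin n))
  | 0, _ => PMF.pure []
  | r + 1, δ => (drawUpdating k δ).bind fun q =>
      (configChecks k r q.2).bind fun F => PMF.pure (q.1 :: F)

/-- The number of check nodes of the configuration model: as many as the sockets allow. -/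
def numChecks (k : ℕ) (d : Fin n → ℕ) : ℕ := (∑ x, d x) / k

/-- The configuration model with degree sequence `d`. -/
def configModel (k : ℕ) (d : Fin n → ℕ) : PMF (List (Fin k → Fin n)) :=
  configChecks k (numChecks k d) d

/-- The number of times that `x` occurs as a neighbour in the check nodes `a`. -/
def multiplicity {m k : ℕ} (a : Fin m → Fin k → Fin n) (x : Fin n) : ℕ :=
  (Finset.univ.filter fun ij : Fin m × Fin k => a ij.1 ij.2 = x).card

/-- The layered graph with layer sizes `m`: in every layer all neighbours are drawn independently
from `ν ∝ δ`, and only after the layer is complete `δ` is replaced by `(δ - ∇)₊`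
(truncated subtraction). Returns the graph and the final residual degrees. -/
def layeredGraph (k : ℕ) : (m : List ℕ) → (Fin n → ℕ) →
    PMF (List (Fin k → Fin n) × (Fin n → ℕ))
  | [], δ => PMF.pure ([], δ)
  | m :: ms, δ => (iid (iid (socketLaw δ) k) m).bind fun a =>
      (layeredGraph k ms (fun x => δ x - multiplicity a x)).bind fun q =>
        PMF.pure (List.ofFn a ++ q.1, q.2)

/-- The number of layers, `⌊(1 - α) β⁻¹ k⁻¹ ∑ₓ d(x)⌋`. -/
def numLayers (k : ℕ) (α β : ℝ) (d : Fin n → ℕ) : ℕ :=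
  ⌊(1 - α) * β⁻¹ * (k : ℝ)⁻¹ * ((∑ x, d x : ℕ) : ℝ)⌋₊

/-- The `(α, β)`-approximation: layers of independent `Po(β)` sizes. -/
def multiPoisson (k : ℕ) (α β : ℝ) (d : Fin n → ℕ) :
    PMF (List (Fin k → Fin n) × (Fin n → ℕ)) :=
  (iid (poisson β.toNNReal) (numLayers k α β d)).bind fun m => layeredGraph k (List.ofFn m) d

/-- The missing check nodes of the graph `q.1` with residual degrees `q.2`: check nodes are
generated by the configuration model from the residual degrees until there are as many as in the
configuration model with degree sequence `d`. -/
def missingChecks (k : ℕ) (d : Fin n → ℕ) (q : List (Fin k → Fin n) × (Fin n → ℕ)) :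
    PMF (List (Fin k → Fin n)) :=
  configChecks k (numChecks k d - q.1.length) q.2

/-! ### Random degree sequences -/

/-- The degree sequences `d` on `n` variable nodes in which exactly `n D(l)` nodes have degree `l`,
for every `l`. Here `D` is a degree distribution on `{0, …, Δ}`. -/
def degreeSequences {Δ : ℕ} (D : PMF (Fin (Δ + 1))) (n : ℕ) : Finset (Fin n → Fin (Δ + 1)) :=
  open Classical in
  Finset.univ.filter fun d =>
    ∀ l, ((Finset.univ.filter fun x => d x = l).card : ℝ≥0∞) = n * D l

/-- A uniformly random `D`-partition of the variable nodes, as a degree sequence. -/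
def degreeLaw {Δ : ℕ} (D : PMF (Fin (Δ + 1))) (h : (degreeSequences D n).Nonempty) :
    PMF (Fin n → ℕ) :=
  (PMF.uniformOfFinset (degreeSequences D n) h).map fun d x => (d x : ℕ)

end Unweighted

/-! ### The teacher-student model -/

/-- A finite set `Ψ` of weight functions `ψ : Ω^k → (0, 2)` together with a prior on it. -/
structure WeightModel (Ω : Type*) (k : ℕ) where
  /-- the weight functions -/
  Ψ : Finset ((Fin k → Ω) → ℝ)
  pos : ∀ ψ ∈ Ψ, ∀ τ, 0 < ψ τ
  lt_two : ∀ ψ ∈ Ψ, ∀ τ, ψ τ < 2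
  /-- the prior distribution on the weight functions -/
  prior : PMF Ψ

section Weighted

variable {Ω : Type*} {k n : ℕ}

/-- The neighbours `(∂₁a, …, ∂ₖa)` in ascending order. -/
def ascending (a : Fin k → Fin n) : Fin k → Fin n := a ∘ Tuple.sort a

/-- A weighted check node: its neighbourhood and its weight function. -/
abbrev CheckNode (W : WeightModel Ω k) (n : ℕ) := (Fin k → Fin n) × W.Ψ

/-- The law of the weight function of a check node with neighbourhood `a` under the ground truth
`σ`: the probability of `ψ` is proportional to `p(ψ) ψ(σ(∂₁a), …, σ(∂ₖa))`. -/
def weightLaw (W : WeightModel Ω k) (σ : Fin n → Ω) (a : Fin k → Fin n) : PMF W.Ψ :=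
  PMF.normalize (fun ψ => W.prior ψ * ENNReal.ofReal (ψ.1 (σ ∘ ascending a)))
    (by
      obtain ⟨ψ, hψ⟩ := W.prior.support_nonempty
      intro h
      have := ENNReal.tsum_eq_zero.1 h ψ
      rw [mul_eq_zero] at this
      rcases this with h | h
      · exact (W.prior.mem_support_iff ψ).1 hψ h
      · exact absurd (ENNReal.ofReal_eq_zero.1 h) (not_le.2 (W.pos _ ψ.2 _)))
    (by
      rw [tsum_fintype]
      exact ENNReal.sum_ne_top.2 fun ψ _ =>
        ENNReal.mul_ne_top (W.prior.apply_ne_top ψ) ENNReal.ofReal_ne_top)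

/-- Attach independent random weight functions to all check nodes. -/
def attachWeights (W : WeightModel Ω k) (σ : Fin n → Ω) :
    List (Fin k → Fin n) → PMF (List (CheckNode W n))
  | [] => PMF.pure []
  | a :: F => (weightLaw W σ a).bind fun ψ =>
      (attachWeights W σ F).bind fun G => PMF.pure ((a, ψ) :: G)

variable [Fintype Ω] [Nonempty Ω] [NeZero n] {Δ : ℕ}

/-- The law of the teacher-student graph over the configuration model with a uniformly random
`D`-partition as degree sequence. -/
def exactGraph (W : WeightModel Ω k) (D : PMF (Fin (Δ + 1)))
    (h : (degreeSequences D n).Nonempty) : PMF (List (CheckNode W n)) :=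
  (PMF.uniformOfFintype (Fin n → Ω)).bind fun σ =>
    (degreeLaw D h).bind fun d =>
      (configModel k d).bind fun F => attachWeights W σ F

/-- The law of the teacher-student graph over the layered multi-Poisson
`(α, β)`-approximation. -/
def approxGraph (W : WeightModel Ω k) (D : PMF (Fin (Δ + 1)))
    (h : (degreeSequences D n).Nonempty) (α β : ℝ) : PMF (List (CheckNode W n)) :=
  (PMF.uniformOfFintype (Fin n → Ω)).bind fun σ =>
    (degreeLaw D h).bind fun d =>
      (multiPoisson k α β d).bind fun q => attachWeights W σ q.1

/-- The joint law of the layered multi-Poisson teacher-student graph and its missing check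
nodes. -/
def approxGraphWithMissing (W : WeightModel Ω k) (D : PMF (Fin (Δ + 1)))
    (h : (degreeSequences D n).Nonempty) (α β : ℝ) :
    PMF (List (CheckNode W n) × List (CheckNode W n)) :=
  (PMF.uniformOfFintype (Fin n → Ω)).bind fun σ =>
    (degreeLaw D h).bind fun d =>
      (multiPoisson k α β d).bind fun q =>
        (attachWeights W σ q.1).bind fun G =>
          (missingChecks k d q).bind fun A =>
            (attachWeights W σ A).bind fun B => PMF.pure (G, B)

/-- Forgetting the missing check nodes gives back the approximation. -/
theorem map_fst_approxGraphWithMissing (W : WeightModel Ω k) (D : PMF (Fin (Δ + 1)))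
    (h : (degreeSequences D n).Nonempty) (α β : ℝ) :
    (approxGraphWithMissing W D h α β).map Prod.fst = approxGraph W D h α β := by
  simp [approxGraphWithMissing, approxGraph, PMF.map_bind, PMF.pure_map, PMF.bind_const,
    PMF.bind_pure]

/-- The number of check nodes that have different neighbourhoods in the two graphs, where the
`i`-th check node of one graph is compared with the `i`-th of the other; a check node that is
present in only one of the graphs counts as different. -/
def numDifferent {W : WeightModel Ω k} (G G' : List (CheckNode W n)) : ℕ :=
  ((Finset.range (max G.length G'.length)).filter fun i =>
    (G[i]?).map Prod.fst ≠ (G'[i]?).map Prod.fst).card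

end Weighted

end FactorGraph

end

/-
Drawing `j` sockets with or without replacement from `S` sockets makes an expected number of at
most `j² / S` draws different. If two degree sequences differ by one additional socket, the same
sockets can be drawn from both until the additional one is drawn, and by exchangeability this draw
can be arranged to be the only different one. Hence the configuration models started from two
degree sequences at `ℓ¹`-distance `l` can be coupled with at most `l` different draws in
expectation.

Replacing the layers of independent draws one at a time by the configuration model thus costs
`3 (m k)² / b` for a layer of size `m`, as long as `b` sockets remain. With `S = ∑ₓ d(x)` and
`b = α S / 2` these costs sum to `O(k (1 + β) / α)`. If the layers use up more sockets, then their
total size deviates from its mean by a multiple of `α S / k`; the trivial bound on the number of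
different check nodes is then paid for by the variance of the Poisson distribution. The same
variance controls the number of missing check nodes.
-/

noncomputable section

namespace FactorGraph

/-! ### Expectations and couplings of discrete laws -/

section Expect

variable {γ γ' : Type*}

theorem expect_mono_support {μ : PMF γ} {g h : γ → ℝ≥0∞} (H : ∀ x ∈ μ.support, g x ≤ h x) :
    expect μ g ≤ expect μ h := by
  refine ENNReal.tsum_le_tsum fun x => ?_
  by_cases hx : μ x = 0
  · simp [hx]
  · gcongr
    exact H x hx

theorem expect_mono (μ : PMF γ) {g h : γ → ℝ≥0∞} (H : ∀ x, g x ≤ h x) :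
    expect μ g ≤ expect μ h :=
  expect_mono_support fun x _ => H x

theorem expect_congr_support {μ : PMF γ} {g h : γ → ℝ≥0∞} (H : ∀ x ∈ μ.support, g x = h x) :
    expect μ g = expect μ h :=
  le_antisymm (expect_mono_support fun x hx => (H x hx).le)
    (expect_mono_support fun x hx => (H x hx).ge)

@[simp]
theorem expect_const (μ : PMF γ) (C : ℝ≥0∞) : expect μ (fun _ => C) = C := by
  simp [expect, ENNReal.tsum_mul_right]

theorem expect_le_of_support {μ : PMF γ} {g : γ → ℝ≥0∞} {C : ℝ≥0∞}
    (H : ∀ x ∈ μ.support, g x ≤ C) : expect μ g ≤ C :=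
  (expect_mono_support H).trans (expect_const μ C).le

theorem expect_add (μ : PMF γ) (g h : γ → ℝ≥0∞) :
    expect μ (fun x => g x + h x) = expect μ g + expect μ h := by
  simp only [expect, mul_add, ENNReal.tsum_add]

theorem expect_const_mul (μ : PMF γ) (C : ℝ≥0∞) (g : γ → ℝ≥0∞) :
    expect μ (fun x => C * g x) = C * expect μ g := by
  simp only [expect, mul_left_comm, ENNReal.tsum_mul_left]

@[simp]
theorem expect_pure (x : γ) (g : γ → ℝ≥0∞) : expect (PMF.pure x) g = g x := by
  rw [expect, tsum_eq_single x fun y hy => by simp [PMF.pure_apply, hy]]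
  simp [PMF.pure_apply]

@[simp]
theorem expect_bind (μ : PMF γ) (K : γ → PMF γ') (g : γ' → ℝ≥0∞) :
    expect (μ.bind K) g = expect μ fun x => expect (K x) g := by
  simp only [expect, PMF.bind_apply, ← ENNReal.tsum_mul_right, ← ENNReal.tsum_mul_left]
  rw [ENNReal.tsum_comm]
  simp only [mul_assoc]

@[simp]
theorem expect_map (μ : PMF γ) (f : γ → γ') (g : γ' → ℝ≥0∞) :
    expect (μ.map f) g = expect μ fun x => g (f x) := by
  simp [← PMF.bind_pure_comp]

theorem toOuterMeasure_eq_expect (μ : PMF γ) (s : Set γ) :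
    μ.toOuterMeasure s = expect μ (s.indicator 1) := by
  rw [PMF.toOuterMeasure_apply]
  refine tsum_congr fun x => ?_
  by_cases hx : x ∈ s <;> simp [hx]

end Expect

section Coupled

variable {γ γ' γ'' θ θ' : Type*}

theorem bind_congr_support {μ : PMF γ} {K K' : γ → PMF γ'} (H : ∀ x ∈ μ.support, K x = K' x) :
    μ.bind K = μ.bind K' := by
  ext y
  exact expect_congr_support fun x hx => by rw [H x hx]

theorem exists_disintegration (μ : PMF γ) (f : γ → γ') :
    ∃ κ : γ' → PMF γ, (μ.map f).bind κ = μ ∧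
      ∀ y ∈ (μ.map f).support, ∀ x ∈ (κ y).support, f x = y := by
  have fiber_inter_support : ∀ y ∈ (μ.map f).support, ∃ x ∈ f ⁻¹' {y}, x ∈ μ.support := by
    intro y hy
    obtain ⟨x, hx, rfl⟩ := (PMF.mem_support_map_iff f μ y).1 hy
    exact ⟨x, rfl, hx⟩
  have : Nonempty (PMF γ) := ⟨μ⟩
  have exists_conditional : ∀ y ∈ (μ.map f).support, ∃ κ : PMF γ,
      (∀ x ∈ κ.support, f x = y) ∧ ∀ x, f x = y → (μ.map f) y * κ x = μ x := by
    intro y hy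
    refine ⟨μ.filter (f ⁻¹' {y}) (fiber_inter_support y hy), fun x hx => ?_, fun x hx => ?_⟩
    · exact ((PMF.mem_support_filter_iff _).1 hx).1
    · have map_apply : (μ.map f) y = ∑' z, (f ⁻¹' {y}).indicator μ z := by
        rw [← PMF.toOuterMeasure_apply_singleton, PMF.toOuterMeasure_map_apply,
          PMF.toOuterMeasure_apply]
      have mem_fiber : x ∈ f ⁻¹' {y} := hx
      rw [PMF.filter_apply, ← map_apply, Set.indicator_of_mem mem_fiber, mul_left_comm,
        ENNReal.mul_inv_cancel hy (PMF.apply_ne_top _ _), mul_one]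
  choose! κ hκ hκμ using exists_conditional
  refine ⟨κ, PMF.ext fun x => ?_, hκ⟩
  rw [PMF.bind_apply, tsum_eq_single (f x)]
  · by_cases hx : f x ∈ (μ.map f).support
    · exact hκμ _ hx x rfl
    · have : μ x = 0 := by
        by_contra h
        exact hx ((PMF.mem_support_map_iff f μ _).2 ⟨x, h, rfl⟩)
      rw [PMF.mem_support_iff, not_not] at hx
      rw [hx, zero_mul, this]
  · intro y hy
    by_contra h
    exact hy (hκ y (left_ne_zero_of_mul h) x (right_ne_zero_of_mul h)).symm

/-- The laws `μ` and `ν` have a coupling under which the cost `c` has expectation at most `C`. -/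
def Coupled (c : γ → γ' → ℝ≥0∞) (μ : PMF γ) (ν : PMF γ') (C : ℝ≥0∞) : Prop :=
  ∃ π : PMF (γ × γ'), π.map Prod.fst = μ ∧ π.map Prod.snd = ν ∧
    expect π (fun p => c p.1 p.2) ≤ C

theorem coupled_pure_left (c : γ → γ' → ℝ≥0∞) (x : γ) (ν : PMF γ') :
    Coupled c (PMF.pure x) ν (expect ν (c x)) :=
  ⟨ν.map (Prod.mk x), (PMF.map_comp _ _ _).trans (PMF.map_const ν x),
    (PMF.map_comp _ _ _).trans (PMF.map_id ν), by simp⟩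

namespace Coupled

variable {c : γ → γ' → ℝ≥0∞} {μ : PMF γ} {ν : PMF γ'} {C : ℝ≥0∞}

theorem mono {C' : ℝ≥0∞} (h : Coupled c μ ν C) (hC : C ≤ C') : Coupled c μ ν C' :=
  let ⟨π, hμ, hν, hc⟩ := h
  ⟨π, hμ, hν, hc.trans hC⟩

theorem mono_cost {c' : γ → γ' → ℝ≥0∞} (h : Coupled c μ ν C)
    (hc : ∀ x ∈ μ.support, ∀ y ∈ ν.support, c' x y ≤ c x y) : Coupled c' μ ν C := by
  obtain ⟨π, rfl, rfl, hC⟩ := h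
  refine ⟨π, rfl, rfl, (expect_mono_support fun p hp => ?_).trans hC⟩
  exact hc _ ((PMF.mem_support_map_iff _ _ _).2 ⟨p, hp, rfl⟩)
    _ ((PMF.mem_support_map_iff _ _ _).2 ⟨p, hp, rfl⟩)

theorem const_add (K : ℝ≥0∞) (h : Coupled c μ ν C) :
    Coupled (fun x y => K + c x y) μ ν (K + C) := by
  obtain ⟨π, hμ, hν, hc⟩ := h
  refine ⟨π, hμ, hν, ?_⟩
  rw [expect_add, expect_const]
  gcongr

theorem const_mul (K : ℝ≥0∞) (h : Coupled c μ ν C) :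
    Coupled (fun x y => K * c x y) μ ν (K * C) := by
  obtain ⟨π, hμ, hν, hc⟩ := h
  refine ⟨π, hμ, hν, ?_⟩
  rw [expect_const_mul]
  gcongr

theorem symm (h : Coupled c μ ν C) : Coupled (fun y x => c x y) ν μ C := by
  obtain ⟨π, rfl, rfl, hc⟩ := h
  exact ⟨π.map Prod.swap, PMF.map_comp _ _ _, PMF.map_comp _ _ _, by simpa using hc⟩

theorem bind_same {c' : θ → θ' → ℝ≥0∞} {K : γ → PMF θ} {K' : γ → PMF θ'} {g : γ → ℝ≥0∞}
    (hg : expect μ g ≤ C) (H : ∀ x ∈ μ.support, Coupled c' (K x) (K' x) (g x)) :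
    Coupled c' (μ.bind K) (μ.bind K') C := by
  obtain ⟨x₀, hx₀⟩ := μ.support_nonempty
  have : Nonempty (PMF (θ × θ')) := ⟨(H x₀ hx₀).choose⟩
  choose! κ hK hK' hc using H
  refine ⟨μ.bind κ, ?_, ?_, ?_⟩
  · rw [PMF.map_bind]
    exact bind_congr_support hK
  · rw [PMF.map_bind]
    exact bind_congr_support hK'
  · rw [expect_bind]
    exact (expect_mono_support hc).trans hg

theorem bind_same_const {c' : θ → θ' → ℝ≥0∞} {K : γ → PMF θ} {K' : γ → PMF θ'}
    (H : ∀ x ∈ μ.support, Coupled c' (K x) (K' x) C) : Coupled c' (μ.bind K) (μ.bind K') C :=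
  bind_same (expect_const μ C).le H

theorem bind {c' : θ → θ' → ℝ≥0∞} {K : γ → PMF θ} {K' : γ' → PMF θ'} (h : Coupled c μ ν C)
    (H : ∀ x ∈ μ.support, ∀ y ∈ ν.support, Coupled c' (K x) (K' y) (c x y)) :
    Coupled c' (μ.bind K) (ν.bind K') C := by
  obtain ⟨π, rfl, rfl, hc⟩ := h
  rw [PMF.bind_map, PMF.bind_map]
  exact bind_same hc fun p hp => H _ ((PMF.mem_support_map_iff _ _ _).2 ⟨p, hp, rfl⟩)
    _ ((PMF.mem_support_map_iff _ _ _).2 ⟨p, hp, rfl⟩)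

theorem of_forall (μ : PMF γ) (ν : PMF γ')
    (h : ∀ x ∈ μ.support, ∀ y ∈ ν.support, c x y ≤ C) : Coupled c μ ν C := by
  have : Coupled c (μ.bind PMF.pure) (μ.bind fun _ => ν) C := bind_same_const fun x hx =>
    (coupled_pure_left c x ν).mono (expect_le_of_support (h x hx))
  simpa only [PMF.bind_pure, PMF.bind_const] using this

theorem pure {x : γ} {y : γ'} (h : c x y ≤ C) : Coupled c (PMF.pure x) (PMF.pure y) C :=
  of_forall _ _ fun x' hx y' hy => by
    rw [PMF.support_pure, Set.mem_singleton_iff] at hx hy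
    rwa [hx, hy]

theorem refl {c : γ → γ → ℝ≥0∞} (μ : PMF γ) (h : ∀ x, c x x ≤ C) : Coupled c μ μ C := by
  have := bind_same_const (μ := μ) fun x _ => pure (h x)
  rwa [PMF.bind_pure] at this

theorem map {c : θ → θ' → ℝ≥0∞} {f : γ → θ} {g : γ' → θ'}
    (h : Coupled (fun x y => c (f x) (g y)) μ ν C) : Coupled c (μ.map f) (ν.map g) C := by
  rw [← PMF.bind_pure_comp, ← PMF.bind_pure_comp]
  exact h.bind fun x _ y _ => pure le_rfl

theorem of_map {c : θ → θ' → ℝ≥0∞} {f : γ → θ} {g : γ' → θ'}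
    (h : Coupled c (μ.map f) (ν.map g) C) : Coupled (fun x y => c (f x) (g y)) μ ν C := by
  obtain ⟨κ, hκ, hκf⟩ := exists_disintegration μ f
  obtain ⟨κ', hκ', hκ'g⟩ := exists_disintegration ν g
  rw [← hκ, ← hκ']
  exact h.bind fun x hx y hy => of_forall _ _ fun a ha b hb => by
    rw [hκf x hx a ha, hκ'g y hy b hb]

/-- The two couplings are glued along their common marginal `ν`. -/
theorem trans {c' : γ' → γ'' → ℝ≥0∞} {c'' : γ → γ'' → ℝ≥0∞} {ρ : PMF γ''} {C' : ℝ≥0∞}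
    (h : Coupled c μ ν C) (h' : Coupled c' ν ρ C') (H : ∀ x y z, c'' x z ≤ c x y + c' y z) :
    Coupled c'' μ ρ (C + C') := by
  obtain ⟨π, rfl, rfl, hc⟩ := h
  obtain ⟨π', hπ', rfl, hc'⟩ := h'
  obtain ⟨κ, hκ, hκ_fst⟩ := exists_disintegration π' Prod.fst
  rw [hπ'] at hκ hκ_fst
  rw [PMF.bind_map] at hκ
  have hsnd : π'.map Prod.snd = π.bind fun p => (κ p.2).map Prod.snd := by
    conv_lhs => rw [← hκ, PMF.map_bind]
    rfl
  rw [hsnd, ← PMF.bind_pure_comp]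
  refine bind_same (g := fun p => c p.1 p.2 + expect (κ p.2) fun q => c' q.1 q.2) ?_
    fun p hp => (coupled_pure_left c'' p.1 _).mono ?_
  · rw [expect_add]
    gcongr
    rwa [← hκ, expect_bind] at hc'
  · rw [expect_map, ← expect_const (κ p.2) (c p.1 p.2), ← expect_add]
    refine expect_mono_support fun q hq => ?_
    have hq_fst : q.1 = p.2 := hκ_fst p.2 ((PMF.mem_support_map_iff _ _ _).2 ⟨p, hp, rfl⟩) q hq
    rw [hq_fst]
    exact H _ _ _

end Coupled

end Coupled

/-! ### Positions at which two lists differ -/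

section ListDiff

open Classical in
/-- The number of positions in which two lists differ; a position that exists in only one of them
counts. -/
def listDiff {γ : Type*} (L L' : List γ) : ℝ≥0∞ :=
  ∑' i : ℕ, if L[i]? = L'[i]? then 0 else 1

variable {γ : Type*}

@[simp]
theorem listDiff_self (L : List γ) : listDiff L L = 0 := by simp [listDiff]

theorem listDiff_comm (L L' : List γ) : listDiff L L' = listDiff L' L := by
  rw [listDiff, listDiff]
  congr! 3
  exact eq_comm

theorem listDiff_triangle (L L' L'' : List γ) :
    listDiff L L'' ≤ listDiff L L' + listDiff L' L'' := by
  rw [listDiff, listDiff, listDiff, ← ENNReal.tsum_add]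
  refine ENNReal.tsum_le_tsum fun i => ?_
  split_ifs <;> simp_all

theorem one_le_listDiff {L L' : List γ} (h : L ≠ L') : 1 ≤ listDiff L L' := by
  obtain ⟨i, hi⟩ : ∃ i : ℕ, L[i]? ≠ L'[i]? := by
    by_contra! hall
    exact h (List.ext_getElem? hall)
  exact (if_neg hi).ge.trans (ENNReal.le_tsum i)

@[simp]
theorem listDiff_cons [DecidableEq γ] (a b : γ) (L L' : List γ) :
    listDiff (a :: L) (b :: L') = (if a = b then 0 else 1) + listDiff L L' := by
  rw [listDiff, tsum_eq_zero_add' ENNReal.summable]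
  simp [listDiff]

theorem listDiff_nil_left (L : List γ) : listDiff [] L = L.length := by
  induction L with
  | nil => simp
  | cons a L ih =>
    have listDiff_nil_cons : listDiff [] (a :: L) = 1 + listDiff [] L := by
      rw [listDiff, tsum_eq_zero_add' ENNReal.summable]
      simp [listDiff]
    rw [listDiff_nil_cons, ih, List.length_cons, Nat.cast_succ, add_comm]

theorem listDiff_le_length_add (L L' : List γ) : listDiff L L' ≤ L.length + L'.length :=
  (listDiff_triangle L [] L').trans_eq <| by
    rw [listDiff_comm L, listDiff_nil_left, listDiff_nil_left]

theorem listDiff_append {L₁ L₁' : List γ} (h : L₁.length = L₁'.length) (L₂ L₂' : List γ) :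
    listDiff (L₁ ++ L₂) (L₁' ++ L₂') = listDiff L₁ L₁' + listDiff L₂ L₂' := by
  classical
  match L₁, L₁', h with
  | [], [], _ => simp
  | a :: L₁, b :: L₁', h =>
    simp [listDiff_append (Nat.succ_inj.1 h), add_assoc]

theorem numDifferent_eq_listDiff {Ω : Type*} {k n : ℕ} {W : WeightModel Ω k}
    (G G' : List (CheckNode W n)) :
    (numDifferent G G' : ℝ≥0∞) = listDiff (G.map Prod.fst) (G'.map Prod.fst) := by
  rw [numDifferent, listDiff, tsum_eq_sum (s := Finset.range (max G.length G'.length))]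
  · rw [Finset.card_filter]
    push_cast
    refine Finset.sum_congr rfl fun i _ => ?_
    simp only [List.getElem?_map, ne_eq, ite_not]
  · intro i hi
    simp only [Finset.mem_range, not_lt, sup_le_iff] at hi
    simp [List.getElem?_eq_none hi.1, List.getElem?_eq_none hi.2]

theorem Coupled.map_cons [DecidableEq γ] {μ ν : PMF (List γ)} {C : ℝ≥0∞}
    (h : Coupled listDiff μ ν C) (x y : γ) :
    Coupled listDiff (μ.map (x :: ·)) (ν.map (y :: ·)) ((if x = y then 0 else 1) + C) := by
  refine Coupled.map ?_
  simp only [listDiff_cons]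
  exact h.const_add _

end ListDiff

/-! ### Residual degrees -/

section Residual

variable {V : Type*} [DecidableEq V]

/-- The residual degrees after the draws `L`, where exhausted degrees stay at `0`. -/
def residual (δ : V → ℕ) (L : List V) : V → ℕ := fun x => δ x - L.count x

@[simp]
theorem residual_nil (δ : V → ℕ) : residual δ [] = δ := by
  funext x
  simp [residual]

theorem residual_append (δ : V → ℕ) (L L' : List V) :
    residual δ (L ++ L') = residual (residual δ L) L' := by
  funext y
  simp only [residual, List.count_append, Nat.sub_sub]

theorem residual_cons (δ : V → ℕ) (x : V) (L : List V) :
    residual δ (x :: L) = residual (residual δ [x]) L :=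
  residual_append δ [x] L

theorem residual_comm (δ : V → ℕ) (L L' : List V) :
    residual (residual δ L) L' = residual (residual δ L') L := by
  funext y
  exact Nat.sub_right_comm _ _ _

theorem residual_singleton (δ : V → ℕ) (x : V) :
    residual δ [x] = fun y => δ y - if y = x then 1 else 0 := by
  funext y
  simp only [residual, List.count_singleton, beq_iff_eq, eq_comm (a := x)]

theorem residual_singleton_of_ne (δ : V → ℕ) {x y : V} (h : y ≠ x) : residual δ [x] y = δ y := by
  simp [residual_singleton, h]

theorem residual_add_single (δ : V → ℕ) (x : V) : residual (δ + Pi.single x 1) [x] = δ := by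
  funext y
  simp [residual_singleton, Pi.single_apply]

theorem residual_singleton_add_single {δ : V → ℕ} {x : V} (h : δ x ≠ 0) :
    residual δ [x] + Pi.single x 1 = δ := by
  funext y
  by_cases hy : y = x
  · subst hy
    simpa [residual_singleton] using Nat.sub_one_add_one h
  · simp [residual_singleton, hy]

theorem residual_add_of_ne_zero {δ : V → ℕ} (η : V → ℕ) {x : V} (h : δ x ≠ 0) :
    residual (δ + η) [x] = residual δ [x] + η := by
  conv_lhs => rw [← residual_singleton_add_single h, add_right_comm, residual_add_single]

variable [Fintype V]

theorem sum_residual_singleton_add_one {δ : V → ℕ} {x : V} (h : δ x ≠ 0) :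
    ∑ y, residual δ [x] y + 1 = ∑ y, δ y := by
  conv_rhs => rw [← residual_singleton_add_single h]
  simp [Finset.sum_add_distrib]

theorem sum_le_sum_residual_add_length (δ : V → ℕ) (L : List V) :
    ∑ y, δ y ≤ ∑ y, residual δ L y + L.length := by
  have sum_count : ∑ y, L.count y = L.length := by
    simpa using Multiset.sum_count_eq_card (m := (L : Multiset V)) fun a _ => Finset.mem_univ a
  rw [← sum_count, ← Finset.sum_add_distrib]
  exact Finset.sum_le_sum fun y _ => le_tsub_add

theorem le_sum_residual_singleton {δ : V → ℕ} {j : ℕ} (h : j + 1 ≤ ∑ y, δ y) (x : V) :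
    j ≤ ∑ y, residual δ [x] y :=
  Nat.le_of_succ_le_succ (h.trans (sum_le_sum_residual_add_length δ [x]))

end Residual

/-! ### Drawing with and without replacement -/

section SocketLaw

variable {n : ℕ} [NeZero n] {δ : Fin n → ℕ}

theorem socketLaw_apply (h : ∑ x, δ x ≠ 0) (x : Fin n) :
    socketLaw δ x = δ x / (∑ y, δ y : ℕ) := by
  rw [socketLaw, dif_neg h, PMF.normalize_apply, tsum_fintype, div_eq_mul_inv]
  push_cast
  rfl

theorem sum_mul_socketLaw (δ : Fin n → ℕ) (x : Fin n) :
    ((∑ y, δ y : ℕ) : ℝ≥0∞) * socketLaw δ x = δ x := by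
  by_cases h : ∑ y, δ y = 0
  · simp [h, Finset.sum_eq_zero_iff.1 h x (Finset.mem_univ x)]
  · rw [socketLaw_apply h]
    exact ENNReal.mul_div_cancel (Nat.cast_ne_zero.2 h) (ENNReal.natCast_ne_top _)

theorem ne_zero_of_mem_support_socketLaw (h : ∑ x, δ x ≠ 0) {x : Fin n}
    (hx : x ∈ (socketLaw δ).support) : δ x ≠ 0 := by
  rintro h0
  simp [PMF.mem_support_iff, socketLaw_apply h, h0] at hx

theorem socketLaw_single (x : Fin n) : socketLaw (Pi.single x 1) = PMF.pure x := by
  ext y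
  rw [socketLaw_apply (by simp), PMF.pure_apply, Pi.single_apply]
  simp

theorem socketLaw_mul_comm (h : 2 ≤ ∑ x, δ x) (x y : Fin n) :
    socketLaw δ x * socketLaw (residual δ [x]) y =
      socketLaw δ y * socketLaw (residual δ [y]) x := by
  rcases eq_or_ne x y with rfl | hxy
  · rfl
  have hδ : ∑ x, δ x ≠ 0 := by omega
  have hres : ∀ z, ∑ y, residual δ [z] y ≠ 0 := fun z =>
    Nat.one_le_iff_ne_zero.1 (le_sum_residual_singleton h z)
  rw [socketLaw_apply hδ, socketLaw_apply hδ, socketLaw_apply (hres x), socketLaw_apply (hres y),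
    residual_singleton_of_ne δ hxy, residual_singleton_of_ne δ hxy.symm]
  by_cases hx : δ x = 0
  · simp [hx]
  by_cases hy : δ y = 0
  · simp [hy]
  have sum_eq : ∑ z, residual δ [x] z = ∑ z, residual δ [y] z := Nat.succ_injective <|
    (sum_residual_singleton_add_one hx).trans (sum_residual_singleton_add_one hy).symm
  rw [sum_eq, div_eq_mul_inv, div_eq_mul_inv, div_eq_mul_inv, div_eq_mul_inv]
  ring

theorem socketLaw_bind_comm {γ : Type*} (h : 2 ≤ ∑ x, δ x) (K : Fin n → Fin n → PMF γ) :
    ((socketLaw δ).bind fun x => (socketLaw (residual δ [x])).bind fun y => K x y) =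
      (socketLaw δ).bind fun y => (socketLaw (residual δ [y])).bind fun x => K x y := by
  ext z
  simp only [PMF.bind_apply, ← ENNReal.tsum_mul_left]
  rw [ENNReal.tsum_comm]
  simp only [← mul_assoc, socketLaw_mul_comm h]

theorem exists_socketLaw_add (η : Fin n → ℕ) (h : ∑ x, δ x ≠ 0) :
    ∃ B : PMF Bool, B true = (∑ x, η x : ℕ) / (∑ x, (δ + η) x : ℕ) ∧
      socketLaw (δ + η) = B.bind fun b => if b then socketLaw η else socketLaw δ := by
  have sum_add : ∑ x, (δ + η) x = ∑ x, η x + ∑ x, δ x := by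
    rw [add_comm]
    exact Finset.sum_add_distrib
  have sum_ne_zero : ∑ x, (δ + η) x ≠ 0 := by omega
  let w : Bool → ℝ≥0∞ := fun b => if b then (∑ x, η x : ℕ) else (∑ x, δ x : ℕ)
  have tsum_w : ∑' b, w b = (∑ x, (δ + η) x : ℕ) := by
    rw [tsum_fintype, sum_add]
    simp [w]
  refine ⟨PMF.normalize w (by rw [tsum_w]; exact_mod_cast sum_ne_zero)
    (by rw [tsum_w]; exact ENNReal.natCast_ne_top _), ?_, PMF.ext fun x => ?_⟩
  · rw [PMF.normalize_apply, tsum_w]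
    rfl
  · rw [PMF.bind_apply, tsum_bool, PMF.normalize_apply, PMF.normalize_apply, tsum_w,
      socketLaw_apply sum_ne_zero, mul_right_comm, mul_right_comm (w true), ← add_mul,
      div_eq_mul_inv]
    simp only [w, if_true, Bool.false_eq_true, if_false, sum_mul_socketLaw]
    rw [add_comm (δ x : ℝ≥0∞), Pi.add_apply, Nat.cast_add, add_comm (δ x : ℝ≥0∞)]

theorem coupled_socketLaw_of_le {ρ : Fin n → ℕ} {m : ℕ} (h : ∑ x, δ x ≠ 0) (hle : δ ≤ ρ)
    (hsum : ∑ x, ρ x ≤ ∑ x, δ x + m) :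
    Coupled (fun x y => if x = y then 0 else 1) (socketLaw δ) (socketLaw ρ)
      (m / (∑ x, ρ x : ℕ)) := by
  obtain ⟨η, rfl⟩ := exists_add_of_le hle
  have hη : ∑ x, η x ≤ m := by
    simpa [Finset.sum_add_distrib] using hsum
  obtain ⟨B, hB, hmix⟩ := exists_socketLaw_add η h
  rw [hmix]
  conv => enter [2]; rw [← PMF.bind_const B (socketLaw δ)]
  refine Coupled.bind_same (g := fun b => if b then 1 else 0) ?_ fun b _ => ?_
  · rw [expect, tsum_bool]
    simp only [Bool.false_eq_true, if_false, if_true, mul_zero, mul_one, zero_add, hB]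
    gcongr
  · cases b with
    | false => exact Coupled.refl _ fun x => by simp
    | true =>
      refine Coupled.of_forall _ _ fun x _ y _ => ?_
      split_ifs <;> simp_all

end SocketLaw

section IidList

variable {γ : Type*}

/-- `j` independent samples from `μ` as a list, the list counterpart of `iid`. -/
def iidList (μ : PMF γ) : (j : ℕ) → PMF (List γ)
  | 0 => PMF.pure []
  | j + 1 => μ.bind fun x => (iidList μ j).map (x :: ·)

theorem iid_map_ofFn (μ : PMF γ) (j : ℕ) : (iid μ j).map List.ofFn = iidList μ j := by
  induction j with
  | zero => simp [iid, iidList, PMF.pure_map]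
  | succ j ih =>
    simp only [iid, iidList, ← ih, PMF.map_bind, PMF.map_comp, PMF.pure_map, List.ofFn_cons]
    rfl

theorem length_of_mem_support_iidList {μ : PMF γ} {j : ℕ} {L : List γ}
    (h : L ∈ (iidList μ j).support) : L.length = j := by
  rw [← iid_map_ofFn, PMF.mem_support_map_iff] at h
  obtain ⟨v, _, rfl⟩ := h
  exact List.length_ofFn

theorem iidList_add (μ : PMF γ) (i j : ℕ) :
    iidList μ (i + j) = (iidList μ i).bind fun L => (iidList μ j).map (L ++ ·) := by
  induction i with
  | zero =>
    rw [Nat.zero_add, iidList, PMF.pure_bind]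
    exact (PMF.map_id _).symm
  | succ i ih =>
    rw [Nat.succ_add]
    simp only [iidList, ih, PMF.map_bind, PMF.bind_bind, PMF.bind_map, PMF.map_comp]
    rfl

end IidList

section DrawList

variable {n : ℕ} [NeZero n] {δ : Fin n → ℕ}

/-- The variable nodes drawn by `drawUpdating`, as a list and without the residual degrees. -/
def drawList : (j : ℕ) → (Fin n → ℕ) → PMF (List (Fin n))
  | 0, _ => PMF.pure []
  | j + 1, δ => (socketLaw δ).bind fun x => (drawList j (residual δ [x])).map (x :: ·)

theorem drawUpdating_map_ofFn (j : ℕ) (δ : Fin n → ℕ) :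
    (drawUpdating j δ).map (fun q => List.ofFn q.1) = drawList j δ := by
  induction j generalizing δ with
  | zero => simp [drawUpdating, drawList, PMF.pure_map]
  | succ j ih =>
    simp only [drawUpdating, drawList, ← ih, residual_singleton, PMF.map_bind, PMF.map_comp,
      PMF.pure_map, List.ofFn_cons]
    rfl

theorem drawList_add (i j : ℕ) (δ : Fin n → ℕ) :
    drawList (i + j) δ = (drawList i δ).bind fun L => (drawList j (residual δ L)).map (L ++ ·) := by
  induction i generalizing δ with
  | zero =>
    rw [Nat.zero_add, drawList, PMF.pure_bind, residual_nil]
    exact (PMF.map_id _).symm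
  | succ i ih =>
    rw [Nat.succ_add]
    simp only [drawList, ih, PMF.map_bind, PMF.bind_bind, PMF.bind_map, PMF.map_comp,
      ← residual_cons, Function.comp_def, List.cons_append]

theorem socketLaw_bind_drawList_comm {γ : Type*} {j : ℕ} (h : j + 1 ≤ ∑ x, δ x)
    (K : Fin n → List (Fin n) → PMF γ) :
    ((socketLaw δ).bind fun x => (drawList j (residual δ [x])).bind (K x)) =
      (drawList j δ).bind fun L => (socketLaw (residual δ L)).bind fun x => K x L := by
  induction j generalizing δ K with
  | zero => simp [drawList]
  | succ j ih =>
    simp only [drawList, PMF.bind_bind, PMF.bind_map, Function.comp_def]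
    rw [socketLaw_bind_comm (Nat.le_of_add_left_le h)]
    congr 1 with y : 1
    simp only [residual_comm δ [_] [y]]
    simpa only [← residual_cons] using
      ih (le_sum_residual_singleton h y) fun x L => K x (y :: L)

/-- By exchangeability a draw that disagrees may be taken to be the last one. -/
theorem coupled_drawList_succ_map_cons {j : ℕ} (h : j + 1 ≤ ∑ x, δ x) (x : Fin n) :
    Coupled listDiff (drawList (j + 1) δ) ((drawList j δ).map (x :: ·)) 1 := by
  have exchange : drawList (j + 1) δ = (drawList j δ).bind fun L =>
      (socketLaw (residual δ L)).bind fun y => PMF.pure (y :: L) := by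
    simp only [drawList, ← PMF.bind_pure_comp]
    exact socketLaw_bind_drawList_comm h fun y L => PMF.pure (y :: L)
  rw [exchange, ← PMF.bind_pure_comp]
  refine Coupled.bind_same_const fun L _ => ?_
  rw [← PMF.bind_const (socketLaw (residual δ L)) ((PMF.pure ∘ _) L)]
  refine Coupled.bind_same_const fun y _ => Coupled.pure ?_
  rw [listDiff_cons, listDiff_self, add_zero]
  split_ifs <;> simp

theorem coupled_drawList_add_single {j : ℕ} (h : j ≤ ∑ x, δ x) (x : Fin n) :
    Coupled listDiff (drawList j δ) (drawList j (δ + Pi.single x 1)) 1 := by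
  induction j generalizing δ with
  | zero => exact Coupled.pure (by simp)
  | succ j ih =>
    have sum_ne_zero : ∑ y, δ y ≠ 0 := by omega
    obtain ⟨B, -, hmix⟩ := exists_socketLaw_add (Pi.single x 1) sum_ne_zero
    rw [drawList.eq_2 (δ + _), hmix, PMF.bind_bind, ← PMF.bind_const B (drawList (j + 1) δ)]
    refine Coupled.bind_same_const fun b _ => ?_
    cases b with
    | true =>
      rw [if_pos rfl, socketLaw_single, PMF.pure_bind, residual_add_single]
      exact coupled_drawList_succ_map_cons h x
    | false =>
      refine Coupled.bind_same_const fun y hy => ?_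
      rw [residual_add_of_ne_zero _ (ne_zero_of_mem_support_socketLaw sum_ne_zero hy)]
      simpa using (ih (le_sum_residual_singleton h y)).map_cons y y

theorem coupled_drawList_add {j : ℕ} (h : j ≤ ∑ x, δ x) (η : Fin n → ℕ) :
    Coupled listDiff (drawList j δ) (drawList j (δ + η)) (∑ x, η x : ℕ) := by
  induction hs : ∑ x, η x generalizing η with
  | zero =>
    obtain rfl : η = 0 := funext fun x => Finset.sum_eq_zero_iff.1 hs x (Finset.mem_univ x)
    exact Coupled.refl _ (by simp)
  | succ s ih =>
    obtain ⟨x, -, hx⟩ : ∃ x ∈ Finset.univ, η x ≠ 0 :=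
      Finset.exists_ne_zero_of_sum_ne_zero (by omega)
    have coupled_residual := ih (residual η [x])
      (Nat.succ_injective ((sum_residual_singleton_add_one hx).trans hs))
    have le_sum : j ≤ ∑ y, (δ + residual η [x]) y :=
      h.trans (Finset.sum_le_sum fun y _ => Nat.le_add_right _ _)
    have coupled_single := coupled_drawList_add_single le_sum x
    rw [add_assoc, residual_singleton_add_single hx] at coupled_single
    rw [Nat.cast_succ]
    exact coupled_residual.trans coupled_single listDiff_triangle

theorem coupled_drawList {j : ℕ} {δ' : Fin n → ℕ} (h : j ≤ ∑ x, δ x) (h' : j ≤ ∑ x, δ' x) :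
    Coupled listDiff (drawList j δ) (drawList j δ') (∑ x, Nat.dist (δ x) (δ' x) : ℕ) := by
  have add_eq_add : δ' + (δ - δ') = δ + (δ' - δ) := by
    funext x
    simp only [Pi.add_apply, Pi.sub_apply]
    omega
  have coupled_left := coupled_drawList_add h (δ' - δ)
  have coupled_right := (coupled_drawList_add h' (δ - δ')).symm
  rw [add_eq_add] at coupled_right
  refine (coupled_left.trans coupled_right fun L₁ L₂ L₃ => ?_).mono ?_
  · rw [listDiff_comm L₃]
    exact listDiff_triangle _ _ _
  · simp only [Nat.dist, Finset.sum_add_distrib, Nat.cast_add, add_comm, Pi.sub_apply, le_refl]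

theorem coupled_drawList_iidList {ρ : Fin n → ℕ} {j m : ℕ} (h : j ≤ ∑ x, δ x) (hle : δ ≤ ρ)
    (hsum : ∑ x, ρ x ≤ ∑ x, δ x + m) :
    Coupled listDiff (drawList j δ) (iidList (socketLaw ρ) j)
      ((j * (m + j) : ℕ) / (∑ x, ρ x : ℕ)) := by
  induction j generalizing δ m with
  | zero => exact Coupled.pure (by simp)
  | succ j ih =>
    have sum_ne_zero : ∑ y, δ y ≠ 0 := by omega
    have coupled_tail : ∀ x ∈ (socketLaw δ).support, Coupled listDiff
        (drawList j (residual δ [x])) (iidList (socketLaw ρ) j)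
        ((j * (m + 1 + j) : ℕ) / (∑ x, ρ x : ℕ)) := fun x hx => by
      have := sum_residual_singleton_add_one (ne_zero_of_mem_support_socketLaw sum_ne_zero hx)
      exact ih (by omega) (fun y => (Nat.sub_le _ _).trans (hle y)) (by omega)
    have coupled_draws := ((coupled_socketLaw_of_le sum_ne_zero hle hsum).const_add
      ((j * (m + 1 + j) : ℕ) / (∑ x, ρ x : ℕ))).bind (c' := listDiff)
      (K := fun x => (drawList j (residual δ [x])).map (x :: ·))
      (K' := fun y => (iidList (socketLaw ρ) j).map (y :: ·)) fun x hx y _ => by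
        rw [add_comm]
        exact (coupled_tail x hx).map_cons x y
    refine coupled_draws.mono ?_
    rw [← ENNReal.add_div, ← Nat.cast_add]
    gcongr
    nlinarith

end DrawList

/-! ### Check nodes as lists of draws -/

section Neighbours

variable {V : Type*} {k : ℕ}

/-- All neighbours of a list of check nodes, in the order in which they are drawn. -/
def neighbours (F : List (Fin k → V)) : List V := F.flatMap List.ofFn

@[simp]
theorem neighbours_nil : neighbours ([] : List (Fin k → V)) = [] := rfl

@[simp]
theorem neighbours_cons (a : Fin k → V) (F : List (Fin k → V)) :
    neighbours (a :: F) = List.ofFn a ++ neighbours F := rfl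

@[simp]
theorem length_neighbours (F : List (Fin k → V)) : (neighbours F).length = F.length * k := by
  simp [neighbours, List.length_flatMap]

theorem listDiff_le_listDiff_neighbours {F F' : List (Fin k → V)} (h : F.length = F'.length) :
    listDiff F F' ≤ listDiff (neighbours F) (neighbours F') := by
  classical
  match F, F', h with
  | [], [], _ => simp
  | a :: F, b :: F', h =>
    rw [listDiff_cons, neighbours_cons, neighbours_cons, listDiff_append (by simp)]
    refine add_le_add ?_ (listDiff_le_listDiff_neighbours (Nat.succ_inj.1 h))
    split_ifs with hab
    · exact zero_le
    · exact one_le_listDiff (List.ofFn_injective.ne hab)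

theorem iidList_map_neighbours (μ : PMF V) (m : ℕ) :
    (iidList (iid μ k) m).map neighbours = iidList μ (m * k) := by
  induction m with
  | zero => simp [iidList, PMF.pure_map]
  | succ m ih =>
    rw [iidList, Nat.succ_mul, add_comm, iidList_add, ← iid_map_ofFn μ k, PMF.map_bind,
      PMF.bind_map]
    simp only [← ih, PMF.map_comp, Function.comp_def, neighbours_cons]

theorem multiplicity_eq_count {n m : ℕ} (a : Fin m → Fin k → Fin n) (x : Fin n) :
    multiplicity a x = (neighbours (List.ofFn a)).count x := by
  have count_ofFn : ∀ b : Fin k → Fin n,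
      (List.ofFn b).count x = ∑ j, if b j = x then 1 else 0 := fun b => by
    rw [← Finset.card_filter, ← Multiset.coe_count, ← Fin.univ_val_map, Multiset.count_map]
    simp only [eq_comm (a := x)]
    rfl
  rw [multiplicity, Finset.card_filter, Fintype.sum_prod_type, neighbours, List.count_flatMap,
    List.map_ofFn, List.sum_ofFn]
  simp only [Function.comp_apply, count_ofFn]

variable [DecidableEq V] [Fintype V]

theorem sum_dist_count_le {L L' : List V} (h : L.length = L'.length) :
    ((∑ x, Nat.dist (L.count x) (L'.count x) : ℕ) : ℝ≥0∞) ≤ 2 * listDiff L L' := by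
  match L, L', h with
  | [], [], _ => simp [Nat.dist_self]
  | a :: L, b :: L', h =>
    have dist_cons_le : ∀ x, Nat.dist ((a :: L).count x) ((b :: L').count x) ≤
        (if a = b then 0 else (if a = x then 1 else 0) + if b = x then 1 else 0) +
          Nat.dist (L.count x) (L'.count x) := fun x => by
      simp only [List.count_cons, beq_iff_eq, Nat.dist]
      split_ifs <;> simp_all <;> omega
    have sum_cons_le : ∑ x, Nat.dist ((a :: L).count x) ((b :: L').count x) ≤
        2 * (if a = b then 0 else 1) + ∑ x, Nat.dist (L.count x) (L'.count x) := by
      refine (Finset.sum_le_sum fun x _ => dist_cons_le x).trans_eq ?_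
      split_ifs <;> simp [Finset.sum_add_distrib]
    rw [listDiff_cons, mul_add]
    refine (Nat.cast_le.2 sum_cons_le).trans ?_
    rw [Nat.cast_add]
    exact add_le_add (by split_ifs <;> simp) (sum_dist_count_le (Nat.succ_inj.1 h))

theorem sum_dist_residual_le (δ : V → ℕ) {L L' : List V} (h : L.length = L'.length) :
    ((∑ x, Nat.dist (residual δ L x) (residual δ L' x) : ℕ) : ℝ≥0∞) ≤ 2 * listDiff L L' := by
  refine le_trans (Nat.cast_le.2 (Finset.sum_le_sum fun x _ => ?_)) (sum_dist_count_le h)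
  simp only [residual, Nat.dist]
  omega

theorem le_sum_residual_neighbours {δ : V → ℕ} {b : ℕ} {F : List (Fin k → V)}
    (h : b + F.length * k ≤ ∑ x, δ x) : b ≤ ∑ x, residual δ (neighbours F) x := by
  have := sum_le_sum_residual_add_length δ (neighbours F)
  rw [length_neighbours] at this
  omega

end Neighbours

section ConfigChecks

variable {n k : ℕ} [NeZero n]

theorem snd_of_mem_support_drawUpdating {j : ℕ} {δ : Fin n → ℕ}
    {q : (Fin j → Fin n) × (Fin n → ℕ)} (h : q ∈ (drawUpdating j δ).support) :
    q.2 = residual δ (List.ofFn q.1) := by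
  induction j generalizing δ with
  | zero =>
    rw [drawUpdating, PMF.mem_support_pure_iff] at h
    simp [h]
  | succ j ih =>
    simp only [drawUpdating, ← residual_singleton, PMF.mem_support_bind_iff,
      PMF.mem_support_pure_iff] at h
    obtain ⟨x, _, q', hq', rfl⟩ := h
    rw [List.ofFn_cons, residual_cons]
    exact ih hq'

theorem length_of_mem_support_configChecks {r : ℕ} {δ : Fin n → ℕ} {F : List (Fin k → Fin n)}
    (h : F ∈ (configChecks k r δ).support) : F.length = r := by
  induction r generalizing δ F with
  | zero =>
    rw [configChecks, PMF.mem_support_pure_iff] at h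
    simp [h]
  | succ r ih =>
    simp only [configChecks, PMF.mem_support_bind_iff, PMF.mem_support_pure_iff] at h
    obtain ⟨q, _, F', hF', rfl⟩ := h
    simp [ih hF']

theorem configChecks_succ (r : ℕ) (δ : Fin n → ℕ) :
    configChecks k (r + 1) δ = (drawUpdating k δ).bind fun q =>
      (configChecks k r (residual δ (List.ofFn q.1))).map (q.1 :: ·) :=
  bind_congr_support fun q hq => by
    rw [snd_of_mem_support_drawUpdating hq, ← PMF.bind_pure_comp]
    rfl

theorem configChecks_map_neighbours (r : ℕ) (δ : Fin n → ℕ) :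
    (configChecks k r δ).map neighbours = drawList (r * k) δ := by
  induction r generalizing δ with
  | zero => simp [configChecks, drawList, PMF.pure_map]
  | succ r ih =>
    rw [configChecks_succ, Nat.succ_mul, add_comm, drawList_add, ← drawUpdating_map_ofFn,
      PMF.map_bind, PMF.bind_map]
    simp only [← ih, PMF.map_comp, Function.comp_def, neighbours_cons]

theorem configChecks_add (i r : ℕ) (δ : Fin n → ℕ) :
    configChecks k (i + r) δ = (configChecks k i δ).bind fun F =>
      (configChecks k r (residual δ (neighbours F))).map (F ++ ·) := by
  induction i generalizing δ with
  | zero =>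
    rw [Nat.zero_add, configChecks, PMF.pure_bind, neighbours_nil, residual_nil]
    exact (PMF.map_id _).symm
  | succ i ih =>
    rw [Nat.succ_add]
    simp only [configChecks_succ, ih, PMF.map_bind, PMF.bind_bind, PMF.bind_map, PMF.map_comp,
      Function.comp_def, neighbours_cons, residual_append, List.cons_append]

theorem coupled_configChecks {r : ℕ} {δ δ' : Fin n → ℕ} (h : r * k ≤ ∑ x, δ x)
    (h' : r * k ≤ ∑ x, δ' x) :
    Coupled listDiff (configChecks k r δ) (configChecks k r δ')
      (∑ x, Nat.dist (δ x) (δ' x) : ℕ) := by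
  have coupled_draws := coupled_drawList h h'
  rw [← configChecks_map_neighbours, ← configChecks_map_neighbours] at coupled_draws
  refine coupled_draws.of_map.mono_cost fun F hF F' hF' => listDiff_le_listDiff_neighbours ?_
  rw [length_of_mem_support_configChecks hF, length_of_mem_support_configChecks hF']

end ConfigChecks

/-! ### The layered graph -/

section LayeredGraph

variable {n k : ℕ} [NeZero n]

theorem layeredGraph_cons (m : ℕ) (ms : List ℕ) (δ : Fin n → ℕ) :
    layeredGraph k (m :: ms) δ = (iidList (iid (socketLaw δ) k) m).bind fun F =>
      (layeredGraph k ms (residual δ (neighbours F))).map fun q => (F ++ q.1, q.2) := by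
  rw [layeredGraph, ← iid_map_ofFn, PMF.bind_map]
  simp only [multiplicity_eq_count, Function.comp_def, ← PMF.bind_pure_comp]
  rfl

theorem length_of_mem_support_layeredGraph {ms : List ℕ} {δ : Fin n → ℕ}
    {q : List (Fin k → Fin n) × (Fin n → ℕ)} (h : q ∈ (layeredGraph k ms δ).support) :
    q.1.length = ms.sum := by
  induction ms generalizing δ q with
  | nil =>
    rw [layeredGraph, PMF.mem_support_pure_iff] at h
    simp [h]
  | cons m ms ih =>
    simp only [layeredGraph, PMF.mem_support_bind_iff, PMF.mem_support_pure_iff] at h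
    obtain ⟨a, _, q', hq', rfl⟩ := h
    simp [ih hq']

/-- The layered graph with layer sizes `ms` together with its missing check nodes, which are drawn
by the configuration model until there are `r` check nodes. -/
def completedGraph (k : ℕ) (ms : List ℕ) (r : ℕ) (δ : Fin n → ℕ) :
    PMF (List (Fin k → Fin n) × List (Fin k → Fin n)) :=
  (layeredGraph k ms δ).bind fun q =>
    (configChecks k (r - q.1.length) q.2).map fun A => (q.1, A)

theorem completedGraph_nil (r : ℕ) (δ : Fin n → ℕ) :
    completedGraph k [] r δ = (configChecks k r δ).map fun A => ([], A) := by
  rw [completedGraph, layeredGraph, PMF.pure_bind]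
  rfl

theorem completedGraph_cons (m : ℕ) (ms : List ℕ) (r : ℕ) (δ : Fin n → ℕ) :
    completedGraph k (m :: ms) r δ = (iidList (iid (socketLaw δ) k) m).bind fun F =>
      (completedGraph k ms (r - m) (residual δ (neighbours F))).map fun q => (F ++ q.1, q.2) := by
  rw [completedGraph, layeredGraph_cons, PMF.bind_bind]
  refine bind_congr_support fun F hF => ?_
  rw [completedGraph, PMF.map_bind, PMF.bind_map]
  simp only [Function.comp_def, PMF.map_comp, List.length_append,
    length_of_mem_support_iidList hF, Nat.sub_sub]

theorem length_of_mem_support_completedGraph {ms : List ℕ} {r : ℕ} {δ : Fin n → ℕ}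
    {q : List (Fin k → Fin n) × List (Fin k → Fin n)}
    (h : q ∈ (completedGraph k ms r δ).support) :
    q.1.length = ms.sum ∧ q.2.length = r - ms.sum := by
  simp only [completedGraph, PMF.mem_support_bind_iff, PMF.mem_support_map_iff] at h
  obtain ⟨q, hq, A, hA, rfl⟩ := h
  have length_eq := length_of_mem_support_layeredGraph hq
  exact ⟨length_eq, length_eq ▸ length_of_mem_support_configChecks hA⟩

theorem coupled_iidList_configChecks {m : ℕ} {b : ℝ≥0∞} {δ : Fin n → ℕ} (hm : m * k ≤ ∑ x, δ x)
    (hb : b ≤ (∑ x, δ x : ℕ)) :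
    Coupled (fun F F' => listDiff (neighbours F) (neighbours F'))
      (iidList (iid (socketLaw δ) k) m) (configChecks k m δ) ((m * k : ℕ) ^ 2 / b) := by
  have coupled_draws := (coupled_drawList_iidList (m := 0) hm le_rfl le_rfl).symm
  rw [← configChecks_map_neighbours, ← iidList_map_neighbours] at coupled_draws
  refine (coupled_draws.of_map.mono_cost fun _ _ _ _ => (listDiff_comm _ _).le).mono ?_
  rw [zero_add, ← sq, Nat.cast_pow]
  gcongr

theorem coupled_append_configChecks {m r : ℕ} {δ : Fin n → ℕ} (h : (m + r) * k ≤ ∑ x, δ x)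
    {F F' : List (Fin k → Fin n)} (hF : F.length = m) (hF' : F'.length = m) :
    Coupled listDiff ((configChecks k r (residual δ (neighbours F))).map (F ++ ·))
      ((configChecks k r (residual δ (neighbours F'))).map (F' ++ ·))
      (3 * listDiff (neighbours F) (neighbours F')) := by
  have length_eq : F.length = F'.length := hF.trans hF'.symm
  rw [add_mul, add_comm] at h
  have coupled_rest : Coupled listDiff (configChecks k r (residual δ (neighbours F)))
      (configChecks k r (residual δ (neighbours F')))
      (2 * listDiff (neighbours F) (neighbours F')) :=
    (coupled_configChecks (le_sum_residual_neighbours (hF ▸ h))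
      (le_sum_residual_neighbours (hF' ▸ h))).mono (sum_dist_residual_le δ (by simp [length_eq]))
  refine Coupled.map ?_
  simp only [listDiff_append length_eq]
  refine (coupled_rest.const_add (listDiff F F')).mono ?_
  calc listDiff F F' + 2 * listDiff (neighbours F) (neighbours F')
      ≤ listDiff (neighbours F) (neighbours F') +
          2 * listDiff (neighbours F) (neighbours F') := by
        gcongr
        exact listDiff_le_listDiff_neighbours length_eq
    _ = 3 * listDiff (neighbours F) (neighbours F') := by ring

theorem coupled_layer {m r : ℕ} {b : ℝ≥0∞} {δ : Fin n → ℕ} (hm : m ≤ r)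
    (hr : r * k ≤ ∑ x, δ x) (hb : b ≤ (∑ x, δ x : ℕ)) :
    Coupled listDiff
      ((iidList (iid (socketLaw δ) k) m).bind fun F =>
        (configChecks k (r - m) (residual δ (neighbours F))).map (F ++ ·))
      (configChecks k r δ) (3 * ((m * k : ℕ) ^ 2 / b)) := by
  obtain ⟨s, rfl⟩ := Nat.exists_eq_add_of_le hm
  rw [configChecks_add, Nat.add_sub_cancel_left]
  have hmk : m * k ≤ ∑ x, δ x := (Nat.mul_le_mul_right k hm).trans hr
  exact ((coupled_iidList_configChecks hmk hb).const_mul 3).bind fun F hF F' hF' =>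
    coupled_append_configChecks hr (length_of_mem_support_iidList hF)
      (length_of_mem_support_configChecks hF')

theorem coupled_completedGraph {ms : List ℕ} {r : ℕ} {b : ℝ≥0∞} {δ : Fin n → ℕ}
    (hm : ms.sum ≤ r) (hr : r * k ≤ ∑ x, δ x) (hb : b + (ms.sum * k : ℕ) ≤ (∑ x, δ x : ℕ)) :
    Coupled (fun q F => listDiff (q.1 ++ q.2) F) (completedGraph k ms r δ) (configChecks k r δ)
      (ms.map fun m => 3 * ((m * k : ℕ) ^ 2 / b)).sum := by
  induction ms generalizing r δ with
  | nil =>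
    rw [completedGraph_nil, ← PMF.map_id (configChecks k r δ), PMF.map_comp]
    exact Coupled.map (Coupled.refl _ (by simp))
  | cons m ms ih =>
    rw [List.sum_cons] at hm hb
    rw [List.map_cons, List.sum_cons, add_comm, completedGraph_cons]
    refine Coupled.trans ?_ (coupled_layer (by omega) hr (le_self_add.trans hb))
      fun q F F' => listDiff_triangle (q.1 ++ q.2) F F'
    refine Coupled.bind_same_const fun F hF => Coupled.map ?_
    simp only [List.append_assoc, listDiff_append (rfl : F.length = F.length), listDiff_self,
      zero_add]
    have length_eq := length_of_mem_support_iidList hF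
    refine ih (Nat.le_sub_of_add_le' hm) (le_sum_residual_neighbours ?_) ?_
    · rwa [length_eq, ← add_mul, Nat.sub_add_cancel (by omega)]
    · have sum_le : ((∑ x, δ x : ℕ) : ℝ≥0∞) ≤
          (∑ x, residual δ (neighbours F) x : ℕ) + (m * k : ℕ) := by
        rw [← length_eq, ← length_neighbours, ← Nat.cast_add]
        exact Nat.cast_le.2 (sum_le_sum_residual_add_length δ _)
      refine ENNReal.le_of_add_le_add_right (ENNReal.natCast_ne_top (m * k)) (le_trans ?_ sum_le)
      refine le_trans (le_of_eq ?_) hb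
      push_cast
      ring

theorem coupled_completedGraph_trivial (ms : List ℕ) (r : ℕ) (δ : Fin n → ℕ) :
    Coupled (fun q F => listDiff (q.1 ++ q.2) F) (completedGraph k ms r δ) (configChecks k r δ)
      (ms.sum + 2 * r : ℕ) := by
  refine Coupled.of_forall _ _ fun q hq F hF => ?_
  obtain ⟨length_fst, length_snd⟩ := length_of_mem_support_completedGraph hq
  refine (listDiff_le_length_add _ _).trans ?_
  rw [length_of_mem_support_configChecks hF, List.length_append, length_fst, length_snd,
    ← Nat.cast_add, Nat.cast_le]
  omega

end LayeredGraph

/-! ### Moments of sums of independent Poisson variables -/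

section Moments

variable {γ : Type*}

theorem expect_ofReal_sq_sub_add_sq {μ : PMF γ} {X : γ → ℕ} {a : ℝ≥0}
    (h : expect μ (fun x => X x) = a) :
    expect μ (fun x => ENNReal.ofReal (((X x : ℝ) - a) ^ 2)) + a ^ 2 =
      expect μ fun x => (X x : ℝ≥0∞) ^ 2 := by
  have sq_sub_add : ∀ j : ℕ, ENNReal.ofReal (((j : ℝ) - a) ^ 2) + 2 * a * j =
      (j : ℝ≥0∞) ^ 2 + a ^ 2 := fun j => by
    rw [← ENNReal.coe_natCast, ← ENNReal.coe_pow, ← ENNReal.coe_pow, ← ENNReal.coe_add,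
      ← ENNReal.ofReal_coe_nnreal (p := j), ← ENNReal.ofReal_coe_nnreal (p := a),
      ← ENNReal.ofReal_ofNat 2, ← ENNReal.ofReal_mul (by positivity),
      ← ENNReal.ofReal_mul (by positivity), ← ENNReal.ofReal_add (by positivity) (by positivity),
      ← ENNReal.ofReal_coe_nnreal]
    push_cast
    ring_nf
  have expect_sq_sub_add := congrArg (expect μ) (funext fun x => sq_sub_add (X x))
  rw [expect_add, expect_add, expect_const_mul, expect_const, h] at expect_sq_sub_add
  refine (ENNReal.add_left_inj (ENNReal.pow_ne_top (n := 2) ENNReal.coe_ne_top)).1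
    (Eq.trans ?_ expect_sq_sub_add)
  ring

theorem expect_iidList_sum_map (μ : PMF γ) (g : γ → ℝ≥0∞) (s : ℕ) :
    expect (iidList μ s) (fun L => (L.map g).sum) = s * expect μ g := by
  induction s with
  | zero => simp [iidList]
  | succ s ih =>
    simp only [iidList, expect_bind, expect_map, List.map_cons, List.sum_cons, expect_add,
      expect_const, ih]
    push_cast
    ring

end Moments

section Poisson

theorem poisson_succ_mul (r : ℝ≥0) (j : ℕ) :
    poisson r (j + 1) * ((j + 1 : ℕ) : ℝ≥0∞) = r * poisson r j := by
  rw [poisson_apply, poisson_apply, ← ENNReal.ofReal_natCast, ← ENNReal.ofReal_mul (by positivity),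
    ← ENNReal.ofReal_coe_nnreal, ← ENNReal.ofReal_mul (by positivity), Nat.factorial_succ]
  congr 1
  push_cast
  field_simp
  exact pow_succ' _ _

theorem expect_poisson_mul (r : ℝ≥0) (g : ℕ → ℝ≥0∞) :
    expect (poisson r) (fun j => j * g j) = r * expect (poisson r) fun j => g (j + 1) := by
  rw [expect, tsum_eq_zero_add' ENNReal.summable, expect, ← ENNReal.tsum_mul_left]
  simp only [Nat.cast_zero, zero_mul, mul_zero, zero_add, ← mul_assoc, poisson_succ_mul]

theorem expect_poisson (r : ℝ≥0) : expect (poisson r) (fun j => j) = r := by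
  simpa using expect_poisson_mul r fun _ => 1

theorem expect_poisson_sq (r : ℝ≥0) :
    expect (poisson r) (fun j => (j : ℝ≥0∞) ^ 2) = r + r ^ 2 := by
  simp only [sq, expect_poisson_mul r fun j => j]
  simp only [Nat.cast_add, Nat.cast_one, expect_add, expect_poisson, expect_const]
  ring

theorem expect_iidList_poisson_sum (r : ℝ≥0) (s : ℕ) :
    expect (iidList (poisson r) s) (fun L => (L.sum : ℝ≥0∞)) = s * r := by
  have := expect_iidList_sum_map (poisson r) (fun j => (j : ℝ≥0∞)) s
  rw [expect_poisson] at this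
  simpa only [Nat.cast_list_sum] using this

theorem expect_iidList_poisson_sum_sq (r : ℝ≥0) (s : ℕ) :
    expect (iidList (poisson r) s) (fun L => (L.sum : ℝ≥0∞) ^ 2) = s * r + (s * r) ^ 2 := by
  induction s with
  | zero => simp [iidList]
  | succ s ih =>
    have add_sq_left : ∀ x y : ℝ≥0∞, (x + y) ^ 2 = x ^ 2 + 2 * x * y + y ^ 2 := add_sq
    have mul_right_comm_two : ∀ x y : ℝ≥0∞, 2 * x * y = 2 * y * x := mul_right_comm 2
    simp only [iidList, expect_bind, expect_map, List.sum_cons, Nat.cast_add, add_sq_left,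
      expect_add, expect_const, expect_const_mul, ih, expect_iidList_poisson_sum]
    simp only [mul_right_comm_two, expect_const_mul, expect_poisson, expect_poisson_sq]
    push_cast
    ring

theorem expect_iidList_poisson_variance (r : ℝ≥0) (s : ℕ) :
    expect (iidList (poisson r) s) (fun L => ENNReal.ofReal (((L.sum : ℝ) - s * r) ^ 2)) =
      s * r := by
  have variance_add_sq := expect_ofReal_sq_sub_add_sq (a := s * r)
    ((expect_iidList_poisson_sum r s).trans (by push_cast; rfl))
  rw [expect_iidList_poisson_sum_sq] at variance_add_sq
  simp only [NNReal.coe_mul, NNReal.coe_natCast, ENNReal.coe_mul, ENNReal.coe_natCast]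
    at variance_add_sq
  refine (ENNReal.add_left_inj ?_).1 variance_add_sq
  exact ENNReal.pow_ne_top (ENNReal.mul_ne_top (ENNReal.natCast_ne_top s) ENNReal.coe_ne_top)

end Poisson

/-! ### The sizes of the layers -/

section LayerSizes

variable {n k : ℕ} {α β : ℝ} {d : Fin n → ℕ}

theorem numLayers_mul_le (hα : α < 1) (hβ : 0 < β) :
    (numLayers k α β d : ℝ) * β ≤ (1 - α) * ((∑ x, d x : ℕ) / k) := by
  have hα' : 0 < 1 - α := sub_pos.2 hα
  refine (mul_le_mul_of_nonneg_right (Nat.floor_le (by positivity)) hβ.le).trans_eq ?_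
  field_simp

theorem numLayers_mul_le_sum_div (hα : 0 < α) (hα' : α < 1) (hβ : 0 < β) :
    (numLayers k α β d : ℝ) * β ≤ (∑ x, d x : ℕ) / k :=
  (numLayers_mul_le hα' hβ).trans (mul_le_of_le_one_left (by positivity) (sub_lt_self 1 hα).le)

theorem le_numLayers_mul_add (hβ : 0 < β) :
    (1 - α) * ((∑ x, d x : ℕ) / k) ≤ (numLayers k α β d : ℝ) * β + β := by
  have lt_succ := Nat.lt_floor_add_one ((1 - α) * β⁻¹ * (k : ℝ)⁻¹ * ((∑ x, d x : ℕ) : ℝ))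
  refine Eq.trans_le ?_ ((mul_le_mul_of_nonneg_right lt_succ.le hβ.le).trans_eq (add_one_mul _ _))
  field_simp

theorem numChecks_le : (numChecks k d : ℝ) ≤ (∑ x, d x : ℕ) / k := Nat.cast_div_le

theorem natCast_mul_coe_toNNReal (s : ℕ) (β : ℝ) :
    (s * β.toNNReal : ℝ≥0∞) = ENNReal.ofReal (s * β) := by
  rw [ENNReal.ofReal_mul (Nat.cast_nonneg s), ENNReal.ofReal_natCast]
  rfl

theorem expect_ofReal_add_mul_sq_le (hα : 0 < α) (hα' : α < 1) (hβ : 0 < β) {a c : ℝ}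
    (ha : 0 ≤ a) (hc : 0 ≤ c) :
    expect (iidList (poisson β.toNNReal) (numLayers k α β d))
        (fun ms => ENNReal.ofReal (a + c * ((ms.sum : ℝ) - numLayers k α β d * β) ^ 2)) ≤
      ENNReal.ofReal (a + c * ((∑ x, d x : ℕ) / k)) := by
  have variance := expect_iidList_poisson_variance β.toNNReal (numLayers k α β d)
  rw [Real.coe_toNNReal _ hβ.le, natCast_mul_coe_toNNReal] at variance
  have ofReal_add_mul : ∀ {t : ℝ}, 0 ≤ t →
      ENNReal.ofReal (a + c * t) = ENNReal.ofReal a + ENNReal.ofReal c * ENNReal.ofReal t :=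
    fun ht => by rw [ENNReal.ofReal_add ha (mul_nonneg hc ht), ENNReal.ofReal_mul hc]
  simp only [ofReal_add_mul (sq_nonneg _)]
  rw [expect_add, expect_const, expect_const_mul, variance, ofReal_add_mul (by positivity)]
  gcongr
  exact numLayers_mul_le_sum_div hα hα' hβ

theorem expect_ofReal_mul_sq_le (hα : 0 < α) (hα' : α < 1) (hβ : 0 < β) {c : ℝ} (hc : 0 ≤ c) :
    expect (iidList (poisson β.toNNReal) (numLayers k α β d))
        (fun ms => ENNReal.ofReal (c * ((ms.sum : ℝ) - numLayers k α β d * β) ^ 2)) ≤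
      ENNReal.ofReal (c * ((∑ x, d x : ℕ) / k)) := by
  simpa only [zero_add] using expect_ofReal_add_mul_sq_le hα hα' hβ le_rfl hc

theorem expect_layer_costs_le (hk : k ≠ 0) (hα : 0 < α) (hα' : α < 1) (hβ : 0 < β)
    (hd : ∑ x, d x ≠ 0) :
    expect (iidList (poisson β.toNNReal) (numLayers k α β d))
        (fun ms => (ms.map fun m =>
          3 * ((m * k : ℕ) ^ 2 / ENNReal.ofReal (α * (∑ x, d x : ℕ) / 2))).sum) ≤
      ENNReal.ofReal (6 * k * (1 + β) / α) := by
  have hS : (0 : ℝ) < (∑ x, d x : ℕ) := Nat.cast_pos.2 (Nat.pos_of_ne_zero hd)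
  set S : ℝ := ((∑ x, d x : ℕ) : ℝ)
  have cost_eq : ∀ m : ℕ, (3 * ((m * k : ℕ) ^ 2 / ENNReal.ofReal (α * S / 2)) : ℝ≥0∞) =
      ENNReal.ofReal (6 * k ^ 2 / (α * S)) * (m : ℝ≥0∞) ^ 2 := fun m => by
    rw [← ENNReal.ofReal_natCast, ← ENNReal.ofReal_natCast, ← ENNReal.ofReal_ofNat,
      ← ENNReal.ofReal_pow (by positivity), ← ENNReal.ofReal_pow (by positivity),
      ← ENNReal.ofReal_div_of_pos (by positivity), ← ENNReal.ofReal_mul (by positivity),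
      ← ENNReal.ofReal_mul (by positivity)]
    congr 1
    push_cast
    field_simp
    ring
  have second_moment : ((numLayers k α β d : ℝ≥0∞) * (β.toNNReal + β.toNNReal ^ 2) : ℝ≥0∞) =
      ENNReal.ofReal (numLayers k α β d * β * (1 + β)) := by
    rw [ENNReal.ofReal_mul (by positivity), ENNReal.ofReal_add zero_le_one hβ.le,
      ← natCast_mul_coe_toNNReal, ENNReal.ofReal_one, ENNReal.ofReal]
    ring
  simp only [cost_eq]
  rw [expect_iidList_sum_map, expect_const_mul, expect_poisson_sq, mul_left_comm, second_moment,
    ← ENNReal.ofReal_mul (by positivity)]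
  refine ENNReal.ofReal_le_ofReal ?_
  calc 6 * k ^ 2 / (α * S) * (numLayers k α β d * β * (1 + β))
      ≤ 6 * k ^ 2 / (α * S) * (S / k * (1 + β)) := by
        gcongr ?_ * (?_ * ?_)
        exact numLayers_mul_le_sum_div hα hα' hβ
    _ = 6 * k * (1 + β) / α := by field_simp

end LayerSizes

/-! ### Comparison of the two graphs -/

section Comparison

variable {n k : ℕ} {α β : ℝ} {d : Fin n → ℕ}

/-- The function `f(α, β)` of the proposition, which bounds the expected number of check nodes
with different neighbourhoods. The first term is the cost of replacing the layers one by one, the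
second one accounts for untypically large layers. -/
def differenceBound (k : ℕ) (α β : ℝ) : ℝ := 6 * k * (1 + β) / α + 14 / α ^ 2

theorem abs_differenceBound_le {ε B : ℝ} (hε : 0 < ε) (hα : ε ≤ α) (hβ : 0 < β) (hB : β ≤ B) :
    |differenceBound k α β| ≤ differenceBound k ε B := by
  have hα' : 0 < α := hε.trans_le hα
  have hB' : 0 < B := hβ.trans_le hB
  have : 0 ≤ differenceBound k α β := by
    rw [differenceBound]
    positivity
  rw [abs_of_nonneg this, differenceBound, differenceBound]
  gcongr

theorem add_two_mul_numChecks_le (hk : k ≠ 0) (hα : 0 < α) (hα' : α < 1) (hβ : 0 < β)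
    (hd : ∑ x, d x ≠ 0) {N : ℕ} (hN : ((∑ x, d x : ℕ) : ℝ) < N * k + α * (∑ x, d x : ℕ) / 2) :
    (N + 2 * numChecks k d : ℝ) ≤
      14 / (α ^ 2 * ((∑ x, d x : ℕ) / k)) * ((N : ℝ) - numLayers k α β d * β) ^ 2 := by
  have hk' : (0 : ℝ) < k := Nat.cast_pos.2 (Nat.pos_of_ne_zero hk)
  have : (0 : ℝ) < (∑ x, d x : ℕ) := Nat.cast_pos.2 (Nat.pos_of_ne_zero hd)
  have numLayers_le := numLayers_mul_le (k := k) (d := d) hα' hβ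
  have numChecks_le := numChecks_le (k := k) (d := d)
  set T : ℝ := (∑ x, d x : ℕ) / k with hT
  have T_pos : 0 < T := by positivity
  have lt_N : T < N + α * T / 2 := by
    rw [hT, div_lt_iff₀ hk']
    refine hN.trans_eq ?_
    field_simp
  set y : ℝ := N - numLayers k α β d * β
  have le_y : α * T ≤ 2 * y := by linarith
  rw [div_mul_eq_mul_div, le_div_iff₀ (by positivity)]
  calc (N + 2 * numChecks k d : ℝ) * (α ^ 2 * T)
      ≤ (y + 3 * T) * (α ^ 2 * T) := by
        refine mul_le_mul_of_nonneg_right ?_ (by positivity)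
        nlinarith
    _ = α * (α * T) * y + 3 * (α * T) ^ 2 := by ring
    _ ≤ 1 * (2 * y) * y + 3 * (2 * y) ^ 2 := by
        have : 0 ≤ y := by nlinarith [mul_pos hα T_pos]
        gcongr
    _ = 14 * y ^ 2 := by ring

variable [NeZero n]

theorem coupled_completedGraph_configModel (hk : k ≠ 0) (hα : 0 < α) (hα' : α < 1) (hβ : 0 < β)
    (hd : ∑ x, d x ≠ 0) (ms : List ℕ) :
    Coupled (fun q F => listDiff (q.1 ++ q.2) F) (completedGraph k ms (numChecks k d) d)
      (configModel k d)
      ((ms.map fun m => 3 * ((m * k : ℕ) ^ 2 / ENNReal.ofReal (α * (∑ x, d x : ℕ) / 2))).sum +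
        ENNReal.ofReal (14 / (α ^ 2 * ((∑ x, d x : ℕ) / k)) *
          ((ms.sum : ℝ) - numLayers k α β d * β) ^ 2)) := by
  rcases le_or_gt ((ms.sum : ℝ) * k + α * (∑ x, d x : ℕ) / 2) (∑ x, d x : ℕ) with hms | hms
  · have sum_mul_le : ms.sum * k ≤ ∑ x, d x := by
      have : 0 ≤ α * ((∑ x, d x : ℕ) : ℝ) / 2 := by positivity
      exact_mod_cast (le_of_add_le_of_nonneg_left hms this)
    refine (coupled_completedGraph ((Nat.le_div_iff_mul_le (Nat.pos_of_ne_zero hk)).2 sum_mul_le)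
      (Nat.div_mul_le_self _ _) ?_).mono le_self_add
    rw [← ENNReal.ofReal_natCast, ← ENNReal.ofReal_natCast (∑ x, d x),
      ← ENNReal.ofReal_add (by positivity) (by positivity), Nat.cast_mul, add_comm]
    exact ENNReal.ofReal_le_ofReal hms
  · refine (coupled_completedGraph_trivial _ _ _).mono (le_add_left ?_)
    rw [← ENNReal.ofReal_natCast]
    refine ENNReal.ofReal_le_ofReal ?_
    rw [Nat.cast_add, Nat.cast_mul, Nat.cast_ofNat]
    exact add_two_mul_numChecks_le hk hα hα' hβ hd hms

theorem multiPoisson_eq_bind_iidList :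
    multiPoisson k α β d = (iidList (poisson β.toNNReal) (numLayers k α β d)).bind fun ms =>
      layeredGraph k ms d := by
  rw [multiPoisson, ← iid_map_ofFn, PMF.bind_map]
  rfl

theorem multiPoisson_bind_missingChecks :
    ((multiPoisson k α β d).bind fun q => (missingChecks k d q).map fun A => (q.1, A)) =
      (iidList (poisson β.toNNReal) (numLayers k α β d)).bind fun ms =>
        completedGraph k ms (numChecks k d) d := by
  rw [multiPoisson_eq_bind_iidList, PMF.bind_bind]
  rfl

theorem coupled_multiPoisson (hk : k ≠ 0) (hα : 0 < α) (hα' : α < 1) (hβ : 0 < β) :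
    Coupled (fun q F => listDiff (q.1 ++ q.2) F)
      ((multiPoisson k α β d).bind fun q => (missingChecks k d q).map fun A => (q.1, A))
      (configModel k d) (ENNReal.ofReal (differenceBound k α β)) := by
  rw [multiPoisson_bind_missingChecks]
  rcases eq_or_ne (∑ x, d x) 0 with hd | hd
  · have no_layers : numLayers k α β d = 0 := by simp [numLayers, hd]
    have no_checks : numChecks k d = 0 := by simp [numChecks, hd]
    rw [no_layers, iidList, PMF.pure_bind, configModel, no_checks]
    exact (coupled_completedGraph_trivial [] 0 d).mono (by simp)
  rw [← PMF.bind_const (iidList (poisson β.toNNReal) (numLayers k α β d)) (configModel k d)]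
  refine Coupled.bind_same ?_ fun ms _ => coupled_completedGraph_configModel hk hα hα' hβ hd ms
  have : (0 : ℝ) < (∑ x, d x : ℕ) := Nat.cast_pos.2 (Nat.pos_of_ne_zero hd)
  rw [expect_add, differenceBound, ENNReal.ofReal_add (by positivity) (by positivity)]
  refine add_le_add (expect_layer_costs_le hk hα hα' hβ hd)
    ((expect_ofReal_mul_sq_le hα hα' hβ (by positivity)).trans_eq ?_)
  congr 1
  field_simp

end Comparison

/-! ### The number of missing check nodes -/

section Missing

variable {n k Δ : ℕ} {α β : ℝ} {d : Fin n → ℕ}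

theorem abs_le_add_sq_div {a : ℝ} (ha : 0 < a) (y : ℝ) : |y| ≤ a + 1 / a * y ^ 2 := by
  rw [← sub_nonneg, ← sq_abs y]
  have completed_square : a + 1 / a * |y| ^ 2 - |y| = ((a - |y|) ^ 2 + a * |y|) / a := by
    field_simp
    ring
  rw [completed_square]
  positivity

theorem sum_div_le (hk : k ≠ 0) (hd : ∑ x, d x ≤ Δ * n) :
    ((∑ x, d x : ℕ) : ℝ) / k ≤ Δ * n := by
  have one_le_k : (1 : ℝ) ≤ k := Nat.one_le_cast.2 (Nat.one_le_iff_ne_zero.2 hk)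
  exact (div_le_self (Nat.cast_nonneg _) one_le_k).trans (by exact_mod_cast hd)

theorem numChecks_sub_le (hk : k ≠ 0) (hα : 0 < α) (hβ : 0 < β) (hd : ∑ x, d x ≤ Δ * n) (N : ℕ) :
    ((numChecks k d - N : ℕ) : ℝ) ≤ α * Δ * n + β + |(N : ℝ) - numLayers k α β d * β| := by
  rcases le_total (numChecks k d) N with hN | hN
  · rw [Nat.sub_eq_zero_of_le hN, Nat.cast_zero]
    positivity
  set T : ℝ := (∑ x, d x : ℕ) / k
  have N_ge := neg_abs_le ((N : ℝ) - numLayers k α β d * β)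
  have αT_le : α * T ≤ α * (Δ * n) := mul_le_mul_of_nonneg_left (sum_div_le hk hd) hα.le
  rw [Nat.cast_sub hN]
  linarith [numChecks_le (k := k) (d := d), le_numLayers_mul_add (k := k) (α := α) (d := d) hβ]

theorem expect_numChecks_sub_le (hk : k ≠ 0) (hα : 0 < α) (hα' : α < 1) (hβ : 0 < β) (hn : n ≠ 0)
    (hd : ∑ x, d x ≤ Δ * n) (hlarge : β + Δ / α ≤ α * n) :
    expect (iidList (poisson β.toNNReal) (numLayers k α β d))
        (fun ms => ((numChecks k d - ms.sum : ℕ) : ℝ≥0∞)) ≤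
      ENNReal.ofReal ((Δ + 2) * α * n) := by
  have hn' : (0 : ℝ) < n := Nat.cast_pos.2 (Nat.pos_of_ne_zero hn)
  calc expect (iidList (poisson β.toNNReal) (numLayers k α β d))
        (fun ms => ((numChecks k d - ms.sum : ℕ) : ℝ≥0∞))
      ≤ expect (iidList (poisson β.toNNReal) (numLayers k α β d)) (fun ms =>
          ENNReal.ofReal (α * Δ * n + β + α * n +
            1 / (α * n) * ((ms.sum : ℝ) - numLayers k α β d * β) ^ 2)) := by
        refine expect_mono _ fun ms => ?_
        rw [← ENNReal.ofReal_natCast]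
        refine ENNReal.ofReal_le_ofReal ((numChecks_sub_le hk hα hβ hd ms.sum).trans ?_)
        rw [add_assoc _ (α * n)]
        gcongr
        exact abs_le_add_sq_div (mul_pos hα hn') _
    _ ≤ ENNReal.ofReal (α * Δ * n + β + α * n + 1 / (α * n) * ((∑ x, d x : ℕ) / k)) :=
        expect_ofReal_add_mul_sq_le hα hα' hβ (by positivity) (by positivity)
    _ ≤ ENNReal.ofReal (α * Δ * n + β + α * n + 1 / (α * n) * (Δ * n)) := by
        gcongr
        exact sum_div_le hk hd
    _ ≤ ENNReal.ofReal ((Δ + 2) * α * n) := by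
        refine ENNReal.ofReal_le_ofReal ?_
        have : 1 / (α * n) * (Δ * n) = Δ / α := by field_simp
        linarith

theorem expect_indicator_numChecks_sub_le (hk : k ≠ 0) (hα : 0 < α) (hα' : α < 1) (hβ : 0 < β)
    (hn : n ≠ 0) {η : ℝ} (hη : 0 < η) (hd : ∑ x, d x ≤ Δ * n) (hβn : β ≤ α * n)
    (hΔn : Δ / (α ^ 2 * η) ≤ n) :
    expect (iidList (poisson β.toNNReal) (numLayers k α β d))
        (fun ms => {l : ℕ | (Δ + 2) * α * n < (l : ℝ)}.indicator 1 (numChecks k d - ms.sum)) ≤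
      ENNReal.ofReal η := by
  have hn' : (0 : ℝ) < n := Nat.cast_pos.2 (Nat.pos_of_ne_zero hn)
  calc expect (iidList (poisson β.toNNReal) (numLayers k α β d))
        (fun ms => {l : ℕ | (Δ + 2) * α * n < (l : ℝ)}.indicator 1 (numChecks k d - ms.sum))
      ≤ expect (iidList (poisson β.toNNReal) (numLayers k α β d)) (fun ms =>
          ENNReal.ofReal (1 / (α * n) ^ 2 *
            ((ms.sum : ℝ) - numLayers k α β d * β) ^ 2)) := by
        refine expect_mono _ fun ms => Set.indicator_apply_le' (fun hms => ?_) fun _ => zero_le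
        have missing_gt : (Δ + 2) * α * n < ((numChecks k d - ms.sum : ℕ) : ℝ) := hms
        have deviation_ge : α * n ≤ |(ms.sum : ℝ) - numLayers k α β d * β| := by
          linarith [numChecks_sub_le hk hα hβ hd ms.sum]
        rw [Pi.one_apply, ENNReal.one_le_ofReal, one_div, ← div_eq_inv_mul,
          one_le_div (by positivity), ← sq_abs ((ms.sum : ℝ) - _)]
        gcongr
    _ ≤ ENNReal.ofReal (1 / (α * n) ^ 2 * ((∑ x, d x : ℕ) / k)) :=
        expect_ofReal_mul_sq_le hα hα' hβ (by positivity)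
    _ ≤ ENNReal.ofReal (1 / (α * n) ^ 2 * (Δ * n)) := by
        gcongr
        exact sum_div_le hk hd
    _ ≤ ENNReal.ofReal η := by
        refine ENNReal.ofReal_le_ofReal ?_
        rw [div_le_iff₀ (by positivity)] at hΔn
        calc 1 / (α * n) ^ 2 * (Δ * n) ≤ 1 / (α * n) ^ 2 * (n * (α ^ 2 * η) * n) := by gcongr
          _ = η := by field_simp

end Missing

/-! ### The teacher-student graphs -/

section Teacher

variable {Ω : Type*} {k n Δ : ℕ}

theorem map_fst_of_mem_support_attachWeights {W : WeightModel Ω k} {σ : Fin n → Ω}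
    {F : List (Fin k → Fin n)} {G : List (CheckNode W n)}
    (h : G ∈ (attachWeights W σ F).support) : G.map Prod.fst = F := by
  induction F generalizing G with
  | nil =>
    rw [attachWeights, PMF.mem_support_pure_iff] at h
    rw [h, List.map_nil]
  | cons a F ih =>
    simp only [attachWeights, PMF.mem_support_bind_iff, PMF.mem_support_pure_iff] at h
    obtain ⟨ψ, -, G', hG', rfl⟩ := h
    rw [List.map_cons, ih hG']

theorem length_of_mem_support_attachWeights {W : WeightModel Ω k} {σ : Fin n → Ω}
    {F : List (Fin k → Fin n)} {G : List (CheckNode W n)}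
    (h : G ∈ (attachWeights W σ F).support) : G.length = F.length := by
  rw [← map_fst_of_mem_support_attachWeights h, List.length_map]

theorem sum_le_of_mem_support_degreeLaw {D : PMF (Fin (Δ + 1))}
    {h : (degreeSequences D n).Nonempty} {d : Fin n → ℕ} (hd : d ∈ (degreeLaw D h).support) :
    ∑ x, d x ≤ Δ * n := by
  rw [degreeLaw, PMF.mem_support_map_iff] at hd
  obtain ⟨d', -, rfl⟩ := hd
  calc ∑ x, (d' x : ℕ) ≤ ∑ _x : Fin n, Δ := Finset.sum_le_sum fun x _ => (d' x).is_le
    _ = Δ * n := by rw [Finset.sum_const, Finset.card_univ, Fintype.card_fin, smul_eq_mul, mul_comm]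

variable [Fintype Ω] [Nonempty Ω] [NeZero n]

theorem approxGraphWithMissing_eq (W : WeightModel Ω k) (D : PMF (Fin (Δ + 1)))
    (h : (degreeSequences D n).Nonempty) (α β : ℝ) :
    approxGraphWithMissing W D h α β =
      (PMF.uniformOfFintype (Fin n → Ω)).bind fun σ => (degreeLaw D h).bind fun d =>
        ((multiPoisson k α β d).bind fun q => (missingChecks k d q).map fun A => (q.1, A)).bind
          fun p => (attachWeights W σ p.1).bind fun G => (attachWeights W σ p.2).map fun B =>
            (G, B) := by
  rw [approxGraphWithMissing]
  refine congrArg _ (funext fun σ => congrArg _ (funext fun d => ?_))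
  rw [PMF.bind_bind]
  refine congrArg _ (funext fun q => ?_)
  rw [PMF.bind_map, PMF.bind_comm]
  rfl

theorem coupled_approxGraphWithMissing (W : WeightModel Ω k) (D : PMF (Fin (Δ + 1)))
    (h : (degreeSequences D n).Nonempty) {α β : ℝ} (hk : k ≠ 0) (hα : 0 < α) (hα' : α < 1)
    (hβ : 0 < β) :
    Coupled (fun p G => (numDifferent (p.1 ++ p.2) G : ℝ≥0∞)) (approxGraphWithMissing W D h α β)
      (exactGraph W D h) (ENNReal.ofReal (differenceBound k α β)) := by
  rw [approxGraphWithMissing_eq, exactGraph]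
  refine Coupled.bind_same_const fun σ _ => Coupled.bind_same_const fun d _ => ?_
  refine (coupled_multiPoisson hk hα hα' hβ).bind fun p _ F _ =>
    Coupled.of_forall _ _ fun GB hGB G' hG' => ?_
  simp only [PMF.mem_support_bind_iff, PMF.mem_support_map_iff] at hGB
  obtain ⟨G, hG, B, hB, rfl⟩ := hGB
  rw [numDifferent_eq_listDiff, List.map_append, map_fst_of_mem_support_attachWeights hG,
    map_fst_of_mem_support_attachWeights hB, map_fst_of_mem_support_attachWeights hG']

theorem expect_length_missing (W : WeightModel Ω k) (D : PMF (Fin (Δ + 1)))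
    (h : (degreeSequences D n).Nonempty) (α β : ℝ) (g : ℕ → ℝ≥0∞) :
    expect (approxGraphWithMissing W D h α β) (fun ω => g ω.2.length) =
      expect (degreeLaw D h) fun d =>
        expect (iidList (poisson β.toNNReal) (numLayers k α β d)) fun ms =>
          g (numChecks k d - ms.sum) := by
  simp only [approxGraphWithMissing_eq, multiPoisson_bind_missingChecks, expect_bind, expect_map]
  rw [← expect_const (PMF.uniformOfFintype (Fin n → Ω)) (expect (degreeLaw D h) _)]
  refine congrArg _ (funext fun σ => congrArg _ (funext fun d => congrArg _ (funext fun ms => ?_)))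
  rw [← expect_const (completedGraph k ms (numChecks k d) d) (g _)]
  refine expect_congr_support fun q hq => ?_
  rw [expect_const, ← (length_of_mem_support_completedGraph hq).2,
    ← expect_const (attachWeights W σ q.2) (g _)]
  exact expect_congr_support fun B hB => by rw [length_of_mem_support_attachWeights hB]

theorem expect_length_missing_le (W : WeightModel Ω k) (D : PMF (Fin (Δ + 1)))
    (h : (degreeSequences D n).Nonempty) {α β : ℝ} (hk : k ≠ 0) (hα : 0 < α) (hα' : α < 1)
    (hβ : 0 < β) (hlarge : β + Δ / α ≤ α * n) :
    expect (approxGraphWithMissing W D h α β) (fun ω => (ω.2.length : ℝ≥0∞)) ≤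
      ENNReal.ofReal ((Δ + 2) * α * n) :=
  (expect_length_missing W D h α β Nat.cast).trans_le <| expect_le_of_support fun _ hd =>
    expect_numChecks_sub_le hk hα hα' hβ (NeZero.ne n) (sum_le_of_mem_support_degreeLaw hd) hlarge

theorem toOuterMeasure_length_missing_le (W : WeightModel Ω k) (D : PMF (Fin (Δ + 1)))
    (h : (degreeSequences D n).Nonempty) {α β η : ℝ} (hk : k ≠ 0) (hα : 0 < α) (hα' : α < 1)
    (hβ : 0 < β) (hη : 0 < η) (hβn : β ≤ α * n) (hΔn : Δ / (α ^ 2 * η) ≤ n) :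
    (approxGraphWithMissing W D h α β).toOuterMeasure {ω | (Δ + 2) * α * n < (ω.2.length : ℝ)} ≤
      ENNReal.ofReal η := by
  rw [toOuterMeasure_eq_expect]
  refine (expect_length_missing W D h α β
    ({l : ℕ | (Δ + 2) * α * n < (l : ℝ)}.indicator 1)).trans_le ?_
  exact expect_le_of_support fun d hd => expect_indicator_numChecks_sub_le hk hα hα' hβ
    (NeZero.ne n) hη (sum_le_of_mem_support_degreeLaw hd) hβn hΔn

end Teacher

end FactorGraph

end

open FactorGraph in
theorem proposition2p2 {Ω : Type*} [Fintype Ω] [Nonempty Ω] (k : ℕ) (hk : 2 ≤ k)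
    (W : WeightModel Ω k) (Δ : ℕ) (D : PMF (Fin (Δ + 1))) :
    ∃ (f : ℝ → ℝ → ℝ) (C : ℝ),
      -- `f` is bounded as long as `α` stays away from `0` and `β` from `∞`
      (∀ ε B : ℝ, 0 < ε → 0 < B → ∃ K : ℝ, ∀ α β : ℝ,
        ε ≤ α → α < 1 → 0 < β → β ≤ B → |f α β| ≤ K) ∧
      ∀ α β : ℝ, 0 < α → α < 1 → 0 < β →
        -- the coupling
        (∀ (n : ℕ) [NeZero n] (h : (degreeSequences D n).Nonempty),
          ∃ μ : PMF ((List (CheckNode W n) × List (CheckNode W n)) × List (CheckNode W n)),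
            μ.map (fun ω => ω.1.1) = approxGraph W D h α β ∧
            μ.map (fun ω => ω.1) = approxGraphWithMissing W D h α β ∧
            μ.map (fun ω => ω.2) = exactGraph W D h ∧
            expect μ (fun ω => (numDifferent (ω.1.1 ++ ω.1.2) ω.2 : ℝ≥0∞))
              ≤ ENNReal.ofReal (f α β)) ∧
        -- `O(α n)` check nodes are missing, in expectation and with high probability
        (∃ n₀ : ℕ, ∀ (n : ℕ) [NeZero n] (h : (degreeSequences D n).Nonempty), n₀ ≤ n →
          expect (approxGraphWithMissing W D h α β) (fun ω => (ω.2.length : ℝ≥0∞))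
            ≤ ENNReal.ofReal (C * α * n)) ∧
        (∀ η : ℝ, 0 < η → ∃ n₀ : ℕ,
          ∀ (n : ℕ) [NeZero n] (h : (degreeSequences D n).Nonempty), n₀ ≤ n →
            (approxGraphWithMissing W D h α β).toOuterMeasure
              {ω | C * α * n < (ω.2.length : ℝ)} ≤ ENNReal.ofReal η) := by
  have hk0 : k ≠ 0 := by omega
  refine ⟨differenceBound k, Δ + 2, fun ε B hε _ => ⟨differenceBound k ε B,
    fun α β hα _ hβ hβB => abs_differenceBound_le hε hα hβ hβB⟩, fun α β hα hα' hβ => ⟨?_, ?_, ?_⟩⟩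
  · intro n _ h
    obtain ⟨μ, hμ, hμ', hdiff⟩ := coupled_approxGraphWithMissing W D h hk0 hα hα' hβ
    refine ⟨μ, ?_, hμ, hμ', hdiff⟩
    rw [← map_fst_approxGraphWithMissing, ← hμ, PMF.map_comp]
    rfl
  · refine ⟨⌈(β + Δ / α) / α⌉₊, fun n _ h hn => ?_⟩
    rw [Nat.ceil_le, div_le_iff₀' hα] at hn
    exact expect_length_missing_le W D h hk0 hα hα' hβ hn
  · intro η hη
    refine ⟨max ⌈β / α⌉₊ ⌈Δ / (α ^ 2 * η)⌉₊, fun n _ h hn => ?_⟩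
    rw [max_le_iff, Nat.ceil_le, Nat.ceil_le, div_le_iff₀' hα] at hn
    exact toOuterMeasure_length_missing_le W D h hk0 hα hα' hβ hη hn.1 hn.2
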